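/- Let $d\in\mathbb N$, let $(\Omega,\mathcal A,\mathbb P)$ be a probability space with a filtration $(\mathcal F_t)_{t\ge 0}$, and let $\xi_1,\xi_2,\dots$ be i.i.d. random elements of a measurable space such that $\xi_t$ is $\mathcal F_t$-measurable and $\xi_{t+1}$ is independent of $\mathcal F_t$; let $\xi$ denote a generic copy. Let $G(x,\xi)\in\mathbb R^d$ be jointly measurable, $g(x)=\mathbb E[G(x,\xi)]$, and let $x^*\in\mathbb R^d$ satisfy $g(x^*)=0$. Starting from an $\mathcal F_0$-measurable $x_0$, put $$x_{t+1}=x_t-\eta_t\,G(x_t,\xi_{t+1}),\qquad t=0,1,2,\dots$$ Vectors carry the Euclidean norm and matrices the spectral norm. Assume the following. 1. (Lyapunov function) There are a differentiable $V:\mathbb R^d\to\mathbb R$ and constants $\delta_V,\mu_V,L_V,\lambda_V>0$ such that $V(0)=0$; $V(x-x^*)\ge\mu_V\|x-x^*\|^2$ for all $x$; $\|\nabla V(y)-\nabla V(z)\|\le L_V\|y-z\|$ for all $y,z$; $\nabla V(x-x^*)^\top g(x)>0$ for all $x\ne x^*$; and $\nabla V(x-x^*)^\top g(x)\ge\lambda_V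 V(x-x^*)$ whenever $\|x-x^*\|\le\delta_V$. 2. (Local linearity) There are $H\in\mathbb R^{d\times d}$ and constants $L_H\ge 0$, $\delta_H>0$, $0<\lambda\le 1$ such that $\|g(x)-H(x-x^*)\|\le L_H\|x-x^*\|^{1+\lambda}$ whenever $\|x-x^*\|\le\delta_H$, and every eigenvalue of $H$ has positive real part. 3. (Lipschitzness of $G$) For some $L_G>0$, $\big(\mathbb E\|G(x,\xi)-G(y,\xi)\|^2\big)^{1/2}\le L_G\|x-y\|$ for all $x,y\in\mathbb R^d$. 4. (Step size) $\eta_t=\eta_0t^{-a}$ for $t\ge 1$, with $\eta_0>0$ (the step size at $t=0$) and $1/2<a<1$. 5. (Noise) Let $\varepsilon_t=g(x_{t-1})-G(x_{t-1},\xi_t)$ for $t\ge 1$. (i) For some $L_\varepsilon>0$ and all $t\ge 1$, $\mathbb E(\|\varepsilon_t\|^2\mid\mathcal F_{t-1})+\|g(x_{t-1})\|^2\le L_\varepsilon(1+\|x_{t-1}-x^*\|^2)$ almost surely. (ii) There are square-integrable random vectors $\varepsilon_t(0)$, $\zeta_t$ ($t\ge1$) with $\varepsilon_t=\varepsilon_t(0)+\zeta_t$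 almost surely such that: (a) $\mathbb E(\varepsilon_t(0)\mid\mathcal F_{t-1})=0$ a.s. for all $t$; (b) $\mathbb E(\varepsilon_t(0)\varepsilon_t(0)^\top\mid\mathcal F_{t-1})\to S$ in probability as $t\to\infty$, where $S\in\mathbb R^{d\times d}$ is symmetric positive definite; (c) $\sup_t\mathbb E(\|\varepsilon_t(0)\|^2\mathbf 1(\|\varepsilon_t(0)\|>C)\mid\mathcal F_{t-1})\to 0$ in probability as $C\to\infty$; (d) for all sufficiently large $t$, $\mathbb E(\|\zeta_t\|^2\mid\mathcal F_{t-1})\le\delta(x_{t-1}-x^*)$ a.s., for a function $\delta:\mathbb R^d\to\mathbb R$ with $\delta(\Delta)\to 0=\delta(0)$ as $\Delta\to 0$. (iii) For some $p>1$ and $C_\varepsilon$, $\mathbb E\|\varepsilon_t\|^{2p}\le C_\varepsilon$ for all $t\ge 1$ and $\mathbb E\|G(x^*,\xi)\|^{2p}\le C_\varepsilon$. 6. (Rate condition) Either $L_H=0$ and $0<a<\frac{p-1}{p}$, or $p>\frac{1+\lambda}{\lambda}$ and $\frac1{1+\lambda}<a<\frac{p-1}{p}$. 7. (Unbiased estimate)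 $\bar H(x,\xi)\in\mathbb R^{d\times d}$ is jointly measurable, $H=\mathbb E[\bar H(x^*,\xi)]$, and $\mathbb E\|\bar H(x^*,\xi)\|^{\bar p}<\infty$ for some $\bar p>1$. 8. (Lipschitzness of $\bar H$) For some $L_{\bar H}>0$, $\big(\mathbb E\|\bar H(x,\xi)-\bar H(y,\xi)\|^2\big)^{1/2}\le L_{\bar H}\|x-y\|$ for all $x,y\in\mathbb R^d$. Define the plug-in estimators $$\widehat H_t=\frac1t\sum_{j=0}^{t-1}\bar H(x_j,\xi_{j+1}),\qquad \widehat S_t=\frac1t\sum_{j=0}^{t-1}G(x_j,\xi_{j+1})G(x_j,\xi_{j+1})^\top .$$ Then $$\widehat H_t=H+\tilde o\Big(t^{-\min\{1-\frac1{\bar p},\,\frac a2\}}\Big)\quad\text{and}\quad \widehat S_t=S+\tilde o\big(t^{-\frac a2}\big)\quad\text{almost surely},$$ where $X_t=\tilde o(r_t)$ almost surely means that there is a deterministic $k$ such that, almost surely, $X_t=o\big(r_t(\log t)^k\big)$ as $t\to\infty$. -/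

import Mathlib

open MeasureTheory ProbabilityTheory Filter Topology Asymptotics
open scoped ENNReal Matrix
-- the norm `‖A‖` of a matrix is the spectral (ℓ² operator) norm
open scoped Matrix.Norms.L2Operator

noncomputable section

namespace StochApprox

/-- `ℝᵈ` with the Euclidean norm. -/
abbrev Vec (d : ℕ) : Type := EuclideanSpace ℝ (Fin d)

/-- Real `d × d` matrices. -/
abbrev Mat (d : ℕ) : Type := Matrix (Fin d) (Fin d) ℝ

/-- The product `A x` of a matrix and a vector. -/
def mulVec {d : ℕ} (A : Mat d) (x : Vec d) : Vec d := WithLp.toLp 2 (A *ᵥ x.ofLp)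

/-- The matrix `x xᵀ`. -/
def outer {d : ℕ} (x : Vec d) : Mat d := Matrix.vecMulVec x.ofLp x.ofLp

section Model

variable {d : ℕ} {Ω Ξ : Type*}

/-- The mean field `g(x) = E[G(x, ξ)]`, where `ξ` has law `ν`. -/
def meanField [MeasurableSpace Ξ] (G : Vec d → Ξ → Vec d) (ν : Measure Ξ) (x : Vec d) : Vec d :=
  ∫ z, G x z ∂ν

/-- The step sizes: `η_t = η₀ t^{-a}` for `t ≥ 1`, and `η₀` at `t = 0`. -/
def stepSize (η₀ a : ℝ) (t : ℕ) : ℝ := if t = 0 then η₀ else η₀ * (t : ℝ) ^ (-a)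

/-- The iterates `x_{t+1} = x_t - η_t G(x_t, ξ_{t+1})` started at `x₀`.
The variable `ξ 0` is never used. -/
def iterate (G : Vec d → Ξ → Vec d) (η : ℕ → ℝ) (ξ : ℕ → Ω → Ξ) (x₀ : Ω → Vec d) :
    ℕ → Ω → Vec d
  | 0 => x₀
  | t + 1 => fun ω =>
      iterate G η ξ x₀ t ω - η t • G (iterate G η ξ x₀ t ω) (ξ (t + 1) ω)

/-- `noise … t` is `ε_{t+1} = g(x_t) - G(x_t, ξ_{t+1})`, for a process `x`. -/
def noise [MeasurableSpace Ξ] (G : Vec d → Ξ → Vec d) (ν : Measure Ξ) (ξ : ℕ → Ω → Ξ)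
    (x : ℕ → Ω → Vec d) (t : ℕ) (ω : Ω) : Vec d :=
  meanField G ν (x t ω) - G (x t ω) (ξ (t + 1) ω)

/-- The plug-in estimator `Ĥ_t = t⁻¹ ∑_{j<t} H̄(x_j, ξ_{j+1})`. -/
def Hhat (Hbar : Vec d → Ξ → Mat d) (ξ : ℕ → Ω → Ξ) (x : ℕ → Ω → Vec d) (t : ℕ) (ω : Ω) :
    Mat d :=
  (t : ℝ)⁻¹ • ∑ j ∈ Finset.range t, Hbar (x j ω) (ξ (j + 1) ω)

/-- The plug-in estimator `Ŝ_t = t⁻¹ ∑_{j<t} G(x_j, ξ_{j+1}) G(x_j, ξ_{j+1})ᵀ`. -/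
def Shat (G : Vec d → Ξ → Vec d) (ξ : ℕ → Ω → Ξ) (x : ℕ → Ω → Vec d) (t : ℕ) (ω : Ω) :
    Mat d :=
  (t : ℝ)⁻¹ • ∑ j ∈ Finset.range t, outer (G (x j ω) (ξ (j + 1) ω))

/-- The data stream: `ξ₁, ξ₂, …` have law `ν`, `ξ_t` is `ℱ_t`-measurable, and `ξ_{t+1}` is
independent of the past `ℱ_t`; in particular `ξ₁, ξ₂, …` are i.i.d. -/
structure IsDataStream [MeasurableSpace Ξ] {mΩ : MeasurableSpace Ω} (P : Measure Ω)
    (ℱ : Filtration ℕ mΩ) (ν : Measure Ξ) (ξ : ℕ → Ω → Ξ) : Prop where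
  adapted : ∀ t, Measurable[ℱ (t + 1)] (ξ (t + 1))
  law : ∀ t, P.map (ξ (t + 1)) = ν
  indep : ∀ t, Indep (MeasurableSpace.comap (ξ (t + 1)) inferInstance) (ℱ t) P

end Model

/-- Lyapunov function: differentiable, vanishing at `0`, quadratically bounded below, with
Lipschitz gradient, decreasing along `-g` on all of `ℝᵈ`, and with the quantitative decrease
`∇V(x - x*)ᵀ g(x) ≥ λ_V V(x - x*)` in the ball of radius `δ_V` around `x*`. -/
def LyapunovCondition {d : ℕ} (g : Vec d → Vec d) (xs : Vec d) : Prop :=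
  ∃ (V : Vec d → ℝ) (δV μV LV lamV : ℝ),
    0 < δV ∧ 0 < μV ∧ 0 < LV ∧ 0 < lamV ∧
    Differentiable ℝ V ∧
    V 0 = 0 ∧
    (∀ x, μV * ‖x - xs‖ ^ 2 ≤ V (x - xs)) ∧
    (∀ y z, ‖gradient V y - gradient V z‖ ≤ LV * ‖y - z‖) ∧
    (∀ x, x ≠ xs → 0 < inner ℝ (gradient V (x - xs)) (g x)) ∧
    (∀ x, ‖x - xs‖ ≤ δV → lamV * V (x - xs) ≤ inner ℝ (gradient V (x - xs)) (g x))

/-- Local linearity of `g` at `x*` with matrix `H`, constant `L_H` and exponent `λ`; all complex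
eigenvalues of `H` have positive real part. The value `L_H = 0` is the linear case. -/
def LocalLinearity {d : ℕ} (g : Vec d → Vec d) (xs : Vec d) (H : Mat d) (LH lam : ℝ) : Prop :=
  0 ≤ LH ∧ 0 < lam ∧ lam ≤ 1 ∧
  (∃ δH : ℝ, 0 < δH ∧ ∀ x, ‖x - xs‖ ≤ δH →
    ‖g x - mulVec H (x - xs)‖ ≤ LH * ‖x - xs‖ ^ (1 + lam)) ∧
  ∀ μ ∈ spectrum ℂ (H.map (fun r : ℝ => (r : ℂ))), 0 < μ.re

/-- Lipschitz continuity in `L²` of a random field `F(·, ξ)`, `ξ ∼ ν`: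
`(E‖F(x, ξ) - F(y, ξ)‖²)^{1/2} ≤ L ‖x - y‖` for all `x`, `y`. -/
def LipschitzL2 {d : ℕ} {Ξ E : Type*} [MeasurableSpace Ξ] [NormedAddCommGroup E]
    (F : Vec d → Ξ → E) (ν : Measure Ξ) : Prop :=
  ∃ L : ℝ, 0 < L ∧ ∀ x y,
    eLpNorm (fun z => F x z - F y z) 2 ν ≤ ENNReal.ofReal (L * ‖x - y‖)

/-- The conditions on the noise `ε_t = g(x_{t-1}) - G(x_{t-1}, ξ_t)`, `t ≥ 1`. Here `eps t`,
`eps0 t`, `zeta t` stand for `ε_{t+1}`, `ε_{t+1}(0)`, `ζ_{t+1}(x_t)`. Square integrability of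
`eps0 t` and `zeta t` makes the conditional second moments meaningful (that of `eps t` follows
from `moment`). -/
structure NoiseCondition {d : ℕ} {Ω Ξ : Type*} [MeasurableSpace Ξ] {mΩ : MeasurableSpace Ω}
    (P : Measure Ω) (ℱ : Filtration ℕ mΩ) (ν : Measure Ξ) (G : Vec d → Ξ → Vec d)
    (xs : Vec d) (x : ℕ → Ω → Vec d) (eps : ℕ → Ω → Vec d) (S : Mat d) (p : ℝ) : Prop where
  /-- `E(‖ε_t‖² | ℱ_{t-1}) + ‖g(x_{t-1})‖² ≤ L_ε (1 + ‖x_{t-1} - x*‖²)` a.s. -/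
  growth : ∃ Lε : ℝ, 0 < Lε ∧ ∀ t, ∀ᵐ ω ∂P,
    (P[fun ω' => ‖eps t ω'‖ ^ 2 | ℱ t]) ω + ‖meanField G ν (x t ω)‖ ^ 2
      ≤ Lε * (1 + ‖x t ω - xs‖ ^ 2)
  /-- The limiting covariance is symmetric and positive definite. -/
  posDef : S.PosDef
  /-- The decomposition `ε_t = ε_t(0) + ζ_t(x_{t-1})`. -/
  decomposition : ∃ eps0 zeta : ℕ → Ω → Vec d,
    (∀ t, MemLp (eps0 t) 2 P) ∧ (∀ t, MemLp (zeta t) 2 P) ∧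
    (∀ t, ∀ᵐ ω ∂P, eps t ω = eps0 t ω + zeta t ω) ∧
    (∀ t, P[eps0 t | ℱ t] =ᵐ[P] 0) ∧
    (∀ i j, TendstoInMeasure P (fun t => P[fun ω => eps0 t ω i * eps0 t ω j | ℱ t]) atTop
      (fun _ => S i j)) ∧
    (∀ κ : ℝ, 0 < κ → Tendsto (fun C : ℝ => P {ω | ENNReal.ofReal κ ≤
      ⨆ t, ENNReal.ofReal
        ((P[{ω' | C < ‖eps0 t ω'‖}.indicator (fun ω' => ‖eps0 t ω'‖ ^ 2) | ℱ t]) ω)})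
      atTop (𝓝 0)) ∧
    ∃ δ : Vec d → ℝ, Tendsto δ (𝓝 0) (𝓝 0) ∧
      ∀ᶠ t in atTop, ∀ᵐ ω ∂P, (P[fun ω' => ‖zeta t ω'‖ ^ 2 | ℱ t]) ω ≤ δ (x t ω - xs)
  one_lt : 1 < p
  /-- `E‖ε_t‖^{2p} ≤ C_ε` for all `t ≥ 1`, and `E‖G(x*, ξ)‖^{2p} ≤ C_ε`. -/
  moment : ∃ Cε : ℝ,
    (∀ t, ∫⁻ ω, ‖eps t ω‖ₑ ^ (2 * p) ∂P ≤ ENNReal.ofReal Cε) ∧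
    ∫⁻ z, ‖G xs z‖ₑ ^ (2 * p) ∂ν ≤ ENNReal.ofReal Cε

/-- The rate condition: linear case or nonlinear case. -/
def RateCondition (lam p a LH : ℝ) : Prop :=
  (LH = 0 ∧ 0 < a ∧ a < (p - 1) / p) ∨
  ((1 + lam) / lam < p ∧ 1 / (1 + lam) < a ∧ a < (p - 1) / p)

/-- `H = E[H̄(x*, ξ)]` with `E‖H̄(x*, ξ)‖^p̄ < ∞` for the exponent `p̄ > 1`. -/
def UnbiasedEstimate {d : ℕ} {Ξ : Type*} [MeasurableSpace Ξ] (Hbar : Vec d → Ξ → Mat d)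
    (ν : Measure Ξ) (xs : Vec d) (H : Mat d) (pbar : ℝ) : Prop :=
  1 < pbar ∧ (∀ i j, H i j = ∫ z, Hbar xs z i j ∂ν) ∧ ∫⁻ z, ‖Hbar xs z‖ₑ ^ pbar ∂ν < ∞

/-- `X_t = õ(r_t)` almost surely: little-o up to a power of `log t`, that is, for some
deterministic `k`, almost surely `X_t = o(r_t (log t)^k)` as `t → ∞`. -/
def IsTildeLittleOAS {Ω E : Type*} [Norm E] {mΩ : MeasurableSpace Ω} (P : Measure Ω)
    (X : ℕ → Ω → E) (r : ℕ → ℝ) : Prop :=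
  ∃ k : ℕ, ∀ᵐ ω ∂P, (fun t => X t ω) =o[atTop] fun t : ℕ => r t * Real.log t ^ k

end StochApprox

end

noncomputable section

namespace StochApprox

/-! ### Deterministic sequences -/

/-- The normalising sequence `(n + 1)ˢ (log (n + 3))²`. -/
def logWeight (s : ℝ) (n : ℕ) : ℝ := ((n : ℝ) + 1) ^ s * Real.log ((n : ℝ) + 3) ^ 2

theorem one_le_log_add_three (n : ℕ) : 1 ≤ Real.log ((n : ℝ) + 3) := by
  rw [Real.le_log_iff_exp_le (by positivity)]
  have := Real.exp_one_lt_d9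
  have : (0 : ℝ) ≤ n := n.cast_nonneg
  linarith

theorem logWeight_pos (s : ℝ) (n : ℕ) : 0 < logWeight s n := by
  have := one_le_log_add_three n
  unfold logWeight
  positivity

theorem logWeight_mono {s : ℝ} (hs : 0 ≤ s) : Monotone (logWeight s) := by
  intro m n hmn
  have h : (m : ℝ) ≤ n := by exact_mod_cast hmn
  have h1 := one_le_log_add_three m
  have h2 : Real.log ((m : ℝ) + 3) ≤ Real.log ((n : ℝ) + 3) :=
    Real.log_le_log (by positivity) (by linarith)
  unfold logWeight
  gcongr

theorem summable_inv_mul_log_sq :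
    Summable fun n : ℕ => (((n : ℝ) + 1) * Real.log ((n : ℝ) + 3) ^ 2)⁻¹ := by
  have hℓ : ∀ n : ℕ, (1 : ℝ) ≤ Real.log ((n : ℝ) + 2 + 1) := fun n => by
    simpa [add_assoc, show (2 : ℝ) + 1 = 3 by norm_num] using one_le_log_add_three n
  have hℓ' : ∀ n : ℕ, (0 : ℝ) < Real.log ((n : ℝ) + 2) := fun n =>
    Real.log_pos (by have : (0 : ℝ) ≤ n := n.cast_nonneg
                     linarith)
  have key : ∀ n : ℕ, (((n : ℝ) + 1) * Real.log ((n : ℝ) + 3) ^ 2)⁻¹ ≤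
      3 * ((Real.log ((n : ℝ) + 2))⁻¹ - (Real.log (((n + 1 : ℕ) : ℝ) + 2))⁻¹) := by
    intro n
    have hn : (0 : ℝ) ≤ n := n.cast_nonneg
    have e : (((n + 1 : ℕ) : ℝ) + 2) = (n : ℝ) + 3 := by push_cast; ring
    rw [e]
    set A := Real.log ((n : ℝ) + 2) with hA
    set B := Real.log ((n : ℝ) + 3) with hB
    have hA0 : 0 < A := hℓ' n
    have hAB : A ≤ B := Real.log_le_log (by positivity) (by linarith)
    have hB0 : 0 < B := hA0.trans_le hAB
    have hd : 1 / ((n : ℝ) + 3) ≤ B - A := by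
      have h1 : A - B ≤ ((n : ℝ) + 2) / ((n : ℝ) + 3) - 1 := by
        rw [hA, hB, ← Real.log_div (by positivity) (by positivity)]
        exact Real.log_le_sub_one_of_pos (by positivity)
      have h2 : ((n : ℝ) + 2) / ((n : ℝ) + 3) - 1 = - (1 / ((n : ℝ) + 3)) := by
        field_simp; ring
      linarith
    have h3 : A⁻¹ - B⁻¹ = (B - A) / (A * B) := by field_simp
    rw [h3]
    have h4 : 1 / ((n : ℝ) + 1) ≤ 3 * (B - A) := by
      have : 1 / ((n : ℝ) + 1) ≤ 3 * (1 / ((n : ℝ) + 3)) := by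
        rw [mul_one_div, div_le_div_iff₀ (by positivity) (by positivity)]; linarith
      linarith
    calc (((n : ℝ) + 1) * B ^ 2)⁻¹ = (1 / ((n : ℝ) + 1)) / (B * B) := by field_simp
      _ ≤ (3 * (B - A)) / (A * B) := by gcongr
      _ = 3 * ((B - A) / (A * B)) := by ring
  refine summable_of_sum_range_le (c := 3 * (Real.log ((0 : ℕ) + 2))⁻¹) (fun n => ?_) (fun n => ?_)
  · positivity
  · refine (Finset.sum_le_sum fun i _ => key i).trans ?_
    rw [← Finset.mul_sum,
      Finset.sum_range_sub' (fun n : ℕ => (Real.log ((n : ℝ) + 2))⁻¹)]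
    have := inv_pos.2 (hℓ' n)
    linarith

theorem summable_rpow_div_logWeight (s : ℝ) :
    Summable fun n : ℕ => ((n : ℝ) + 1) ^ (s - 1) / logWeight s n := by
  refine summable_inv_mul_log_sq.congr fun n => ?_
  have := one_le_log_add_three n
  have h1 : (0 : ℝ) < (n : ℝ) + 1 := by positivity
  unfold logWeight
  rw [Real.rpow_sub_one h1.ne']
  have := Real.rpow_pos_of_pos h1 s
  field_simp

theorem summable_logWeight_rpow_neg {q : ℝ} (hq : 1 ≤ q) :
    Summable fun n : ℕ => logWeight (1 / q) n ^ (-q) := by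
  refine Summable.of_nonneg_of_le (fun n => (Real.rpow_pos_of_pos (logWeight_pos _ n) _).le)
    (fun n => ?_) summable_inv_mul_log_sq
  have hl := one_le_log_add_three n
  have h1 : (0 : ℝ) < (n : ℝ) + 1 := by positivity
  rw [Real.rpow_neg (logWeight_pos _ n).le]
  unfold logWeight
  rw [Real.mul_rpow (by positivity) (by positivity), ← Real.rpow_mul h1.le,
    one_div_mul_cancel (by linarith), Real.rpow_one]
  have h2 : Real.log ((n : ℝ) + 3) ^ 2 ≤ (Real.log ((n : ℝ) + 3) ^ 2) ^ q := by
    conv_lhs => rw [← Real.rpow_one (Real.log ((n : ℝ) + 3) ^ 2)]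
    exact Real.rpow_le_rpow_of_exponent_le (one_le_pow₀ hl) hq
  gcongr

theorem logWeight_div_isLittleO {s r : ℝ} (hs : 0 ≤ s) (hr : r ≤ 1 - s) :
    (fun n : ℕ => logWeight s n * (n : ℝ)⁻¹) =o[atTop]
      fun n : ℕ => (n : ℝ) ^ (-r) * Real.log n ^ 3 := by
  have h1 : (fun n : ℕ => logWeight s n * (n : ℝ)⁻¹) =O[atTop]
      fun n : ℕ => (n : ℝ) ^ (-r) * Real.log n ^ 2 := by
    refine IsBigO.of_bound (2 ^ s * 4) ?_
    filter_upwards [eventually_ge_atTop 3] with n hn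
    have hn' : (3 : ℝ) ≤ n := by exact_mod_cast hn
    have hn0 : (0 : ℝ) < n := by linarith
    have hl0 : 0 ≤ Real.log n := Real.log_nonneg (by linarith)
    have hl : Real.log ((n : ℝ) + 3) ≤ 2 * Real.log n := by
      have : Real.log ((n : ℝ) ^ 2) = 2 * Real.log n := by simp
      rw [← this]
      exact Real.log_le_log (by positivity) (by nlinarith)
    have hl1 := one_le_log_add_three n
    have h2 : ((n : ℝ) + 1) ^ s ≤ 2 ^ s * (n : ℝ) ^ s := by
      rw [← Real.mul_rpow (by norm_num) hn0.le]
      exact Real.rpow_le_rpow (by positivity) (by linarith) hs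
    have h3 : (n : ℝ) ^ s * (n : ℝ)⁻¹ ≤ (n : ℝ) ^ (-r) := by
      rw [← Real.rpow_neg_one, ← Real.rpow_add hn0]
      exact Real.rpow_le_rpow_of_exponent_le (by linarith) (by linarith)
    rw [Real.norm_of_nonneg (mul_nonneg (logWeight_pos _ n).le (by positivity)),
      Real.norm_of_nonneg (by positivity)]
    unfold logWeight
    calc ((n : ℝ) + 1) ^ s * Real.log ((n : ℝ) + 3) ^ 2 * (n : ℝ)⁻¹
        ≤ (2 ^ s * (n : ℝ) ^ s) * (2 * Real.log n) ^ 2 * (n : ℝ)⁻¹ := by gcongr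
      _ = 2 ^ s * 4 * (((n : ℝ) ^ s * (n : ℝ)⁻¹) * Real.log n ^ 2) := by ring
      _ ≤ 2 ^ s * 4 * ((n : ℝ) ^ (-r) * Real.log n ^ 2) := by gcongr
  refine h1.trans_isLittleO ?_
  refine (isBigO_refl (fun n : ℕ => (n : ℝ) ^ (-r)) atTop).mul_isLittleO ?_
  have h2 : Tendsto (fun n : ℕ => Real.log (n : ℝ)) atTop atTop :=
    Real.tendsto_log_atTop.comp tendsto_natCast_atTop_atTop
  exact (isLittleO_pow_pow_atTop_of_lt (𝕜 := ℝ) (by norm_num : 2 < 3)).comp_tendsto h2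

/-- Summation by parts: bounded partial sums of `X_j / b_j` with `b` nondecreasing give
`∑_{j<n} X_j = O(b_n)`. -/
theorem abs_sum_le_of_abs_sum_div_le {X b : ℕ → ℝ} {K : ℝ} (hb : ∀ n, 0 < b n)
    (hmono : Monotone b) (hK : ∀ n, |∑ j ∈ Finset.range n, X j / b j| ≤ K) (n : ℕ) :
    |∑ j ∈ Finset.range n, X j| ≤ 2 * K * b n := by
  set M : ℕ → ℝ := fun n => ∑ j ∈ Finset.range n, X j / b j with hM
  have habel : ∀ n, ∑ j ∈ Finset.range n, X j =
      b n * M n - ∑ j ∈ Finset.range n, (b (j + 1) - b j) * M (j + 1) := by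
    intro n
    induction n with
    | zero => simp [hM]
    | succ n ih =>
      have h1 : M (n + 1) = M n + X n / b n := by simp [hM, Finset.sum_range_succ]
      have h2 : X n = b n * (X n / b n) := by field_simp [(hb n).ne']
      rw [Finset.sum_range_succ, ih, Finset.sum_range_succ, h1]
      nth_rewrite 1 [h2]
      ring
  have hK0 : 0 ≤ K := (abs_nonneg _).trans (hK 0)
  have h3 : |∑ j ∈ Finset.range n, (b (j + 1) - b j) * M (j + 1)| ≤ K * b n := by
    calc |∑ j ∈ Finset.range n, (b (j + 1) - b j) * M (j + 1)|
        ≤ ∑ j ∈ Finset.range n, |(b (j + 1) - b j) * M (j + 1)| := Finset.abs_sum_le_sum_abs _ _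
      _ ≤ ∑ j ∈ Finset.range n, (b (j + 1) - b j) * K := by
          refine Finset.sum_le_sum fun j _ => ?_
          have h : 0 ≤ b (j + 1) - b j := sub_nonneg.2 (hmono j.le_succ)
          rw [abs_mul, abs_of_nonneg h]
          exact mul_le_mul_of_nonneg_left (hK (j + 1)) h
      _ = (b n - b 0) * K := by rw [← Finset.sum_mul, Finset.sum_range_sub]
      _ ≤ K * b n := by nlinarith [hb 0]
  have h4 : |b n * M n| ≤ K * b n := by
    rw [abs_mul, abs_of_pos (hb n), mul_comm]
    exact mul_le_mul_of_nonneg_right (hK n) (hb n).le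
  rw [habel n]
  calc _ ≤ |b n * M n| + |∑ j ∈ Finset.range n, (b (j + 1) - b j) * M (j + 1)| := abs_sub _ _
    _ ≤ 2 * K * b n := by linarith

theorem rpow_neg_sub_le_rpow_neg_add_one {a y : ℝ} (ha : 0 ≤ a) (hy : 0 < y) :
    y ^ (-a) - a * (y ^ (-a) * y⁻¹) ≤ (y + 1) ^ (-a) := by
  have h1 : (y + 1) ^ (-a) = y ^ (-a) * (1 + y⁻¹) ^ (-a) := by
    rw [← Real.mul_rpow hy.le (by positivity)]
    congr 1
    field_simp
  have h2 : 1 - a * y⁻¹ ≤ (1 + y⁻¹) ^ (-a) := by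
    rw [Real.rpow_def_of_pos (by positivity)]
    have h3 := Real.log_le_sub_one_of_pos (show 0 < 1 + y⁻¹ by positivity)
    have h4 := Real.add_one_le_exp (Real.log (1 + y⁻¹) * -a)
    nlinarith
  rw [h1]
  have := mul_le_mul_of_nonneg_left h2 (Real.rpow_pos_of_pos hy (-a)).le
  linarith

/-- Solution of the recursion `u_{j+1} ≤ (1 - c j^{-a}) u_j + C j^{-2a}` with `0 < a < 1`. -/
theorem eventually_le_rpow_of_recursion {u : ℕ → ℝ} {a c C : ℝ} (ha : 0 < a) (ha' : a < 1)
    (hc : 0 < c)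
    (h : ∀ᶠ j : ℕ in atTop,
      u (j + 1) ≤ (1 - c * (j : ℝ) ^ (-a)) * u j + C * ((j : ℝ) ^ (-a)) ^ 2) :
    ∃ K : ℝ, ∀ᶠ j : ℕ in atTop, u j ≤ K * (j : ℝ) ^ (-a) := by
  have t1 : Tendsto (fun j : ℕ => c * (j : ℝ) ^ (-a)) atTop (𝓝 0) := by
    simpa using ((tendsto_rpow_neg_atTop ha).comp tendsto_natCast_atTop_atTop).const_mul c
  have t2 : Tendsto (fun j : ℕ => a * (j : ℝ) ^ (-(1 - a))) atTop (𝓝 0) := by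
    simpa using ((tendsto_rpow_neg_atTop (sub_pos.2 ha')).comp
      tendsto_natCast_atTop_atTop).const_mul a
  obtain ⟨J, hJ⟩ := eventually_atTop.1 (h.and ((t1.eventually (ge_mem_nhds one_pos)).and
    ((t2.eventually (ge_mem_nhds (half_pos hc))).and (eventually_ge_atTop 1))))
  have hJ1 : (0 : ℝ) < J := by exact_mod_cast (hJ J le_rfl).2.2.2
  set K := max (2 * |C| / c) (|u J| / (J : ℝ) ^ (-a)) with hKdef
  have hK0 : 0 ≤ K := le_max_of_le_left (by positivity)
  have hK1 : |C| ≤ c * K / 2 := by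
    have := le_max_left (2 * |C| / c) (|u J| / (J : ℝ) ^ (-a))
    rw [← hKdef, div_le_iff₀ hc] at this
    linarith
  refine ⟨K, eventually_atTop.2 ⟨J, fun j hj => ?_⟩⟩
  induction j, hj using Nat.le_induction with
  | base =>
    have := le_max_right (2 * |C| / c) (|u J| / (J : ℝ) ^ (-a))
    rw [← hKdef, div_le_iff₀ (Real.rpow_pos_of_pos hJ1 _)] at this
    exact (le_abs_self _).trans this
  | succ j hj ih =>
    obtain ⟨h1, h2, h3, h4⟩ := hJ j hj
    have hj0 : (0 : ℝ) < j := by exact_mod_cast h4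
    set y := (j : ℝ) ^ (-a) with hy
    have hy0 : 0 < y := Real.rpow_pos_of_pos hj0 _
    have h5 : a * (j : ℝ)⁻¹ ≤ c / 2 * y := by
      have e : (j : ℝ)⁻¹ = (j : ℝ) ^ (-(1 - a)) * y := by
        rw [hy, ← Real.rpow_add hj0, ← Real.rpow_neg_one]; congr 1; ring
      rw [e, ← mul_assoc]
      exact mul_le_mul_of_nonneg_right h3 hy0.le
    have h6 := rpow_neg_sub_le_rpow_neg_add_one ha.le hj0
    have h7 : C ≤ c * K / 2 := (le_abs_self C).trans hK1
    push_cast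
    calc u (j + 1) ≤ (1 - c * y) * u j + C * y ^ 2 := h1
      _ ≤ (1 - c * y) * (K * y) + c * K / 2 * y ^ 2 := by
          gcongr
      _ = K * (y - c / 2 * y * y) := by ring
      _ ≤ K * (y - a * (j : ℝ)⁻¹ * y) := by gcongr
      _ = K * (y - a * (y * (j : ℝ)⁻¹)) := by ring
      _ ≤ K * ((j : ℝ) + 1) ^ (-a) := by gcongr

/-! ### Probabilistic tools -/

/-- Integrating out a variable that is independent of the past. -/
theorem lintegral_mul_comp_eq_of_indep {Ω Ξ E : Type*} [MeasurableSpace Ξ] [MeasurableSpace E]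
    {m mΩ : MeasurableSpace Ω} {P : Measure Ω} [IsProbabilityMeasure P]
    (hm : m ≤ mΩ) {ξ : Ω → Ξ} (hξ : Measurable ξ)
    (hind : Indep (MeasurableSpace.comap ξ inferInstance) m P)
    {X : Ω → E} (hX : Measurable[m] X) {U : Ω → ℝ≥0∞} (hU : Measurable[m] U)
    {φ : E × Ξ → ℝ≥0∞} (hφ : Measurable φ) :
    ∫⁻ ω, U ω * φ (X ω, ξ ω) ∂P = ∫⁻ ω, U ω * ∫⁻ z, φ (X ω, z) ∂(P.map ξ) ∂P := by
  have hZm : Measurable[m] (fun ω => (X ω, U ω)) := hX.prodMk hU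
  have hZ : Measurable (fun ω => (X ω, U ω)) := hZm.mono hm le_rfl
  have hi : IndepFun (fun ω => (X ω, U ω)) ξ P := by
    rw [IndepFun_iff_Indep]
    exact indep_of_indep_of_le_left hind.symm hZm.comap_le
  have hψ : Measurable (fun y : (E × ℝ≥0∞) × Ξ => y.1.2 * φ (y.1.1, y.2)) := by fun_prop
  have : IsProbabilityMeasure (P.map ξ) := Measure.isProbabilityMeasure_map hξ.aemeasurable
  have hmap := (indepFun_iff_map_prod_eq_prod_map_map hZ.aemeasurable hξ.aemeasurable).1 hi
  calc ∫⁻ ω, U ω * φ (X ω, ξ ω) ∂P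
      = ∫⁻ y, y.1.2 * φ (y.1.1, y.2) ∂(P.map (fun ω => ((X ω, U ω), ξ ω))) := by
        rw [lintegral_map hψ (hZ.prodMk hξ)]
    _ = ∫⁻ w, ∫⁻ z, w.2 * φ (w.1, z) ∂(P.map ξ) ∂(P.map (fun ω => (X ω, U ω))) := by
        rw [hmap, lintegral_prod _ hψ.aemeasurable]
    _ = ∫⁻ ω, ∫⁻ z, U ω * φ (X ω, z) ∂(P.map ξ) ∂P := by
        rw [lintegral_map hψ.lintegral_prod_right' hZ]
    _ = _ := by
        refine lintegral_congr fun ω => ?_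
        rw [lintegral_const_mul _ (by fun_prop)]

theorem ae_summable_of_lintegral_le {Ω : Type*} {mΩ : MeasurableSpace Ω} {P : Measure Ω}
    {Y : ℕ → Ω → ℝ} (hY : ∀ j, Measurable (Y j)) (hY0 : ∀ j ω, 0 ≤ Y j ω) {e : ℕ → ℝ}
    (he : Summable e) (hle : ∀ j, ∫⁻ ω, ENNReal.ofReal (Y j ω) ∂P ≤ ENNReal.ofReal (e j)) :
    ∀ᵐ ω ∂P, Summable fun j => Y j ω := by
  have h1 : ∫⁻ ω, ∑' j, ENNReal.ofReal (Y j ω) ∂P ≠ ∞ := by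
    rw [lintegral_tsum fun j => (hY j).ennreal_ofReal.aemeasurable]
    exact ((ENNReal.tsum_le_tsum hle).trans_lt he.tsum_ofReal_lt_top).ne
  filter_upwards [ae_lt_top (by fun_prop) h1] with ω hω
  have h2 : ∀ j, ENNReal.ofReal (Y j ω) ≠ ∞ := fun j => ENNReal.ofReal_ne_top
  refine (ENNReal.summable_toReal hω.ne).congr fun j => ?_
  rw [ENNReal.toReal_ofReal (hY0 j ω)]

/-- A nonnegative supermartingale, described through set integrals, converges almost surely. -/
theorem ae_tendsto_of_nonneg_supermartingale {Ω : Type*} {mΩ : MeasurableSpace Ω} {P : Measure Ω}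
    [IsProbabilityMeasure P] {ℱ : Filtration ℕ mΩ} {W : ℕ → Ω → ℝ}
    (hW : ∀ n, Measurable[ℱ n] (W n)) (hW0 : ∀ n ω, 0 ≤ W n ω) (hint : Integrable (W 0) P)
    (hle : ∀ n, ∀ B, MeasurableSet[ℱ n] B →
      ∫⁻ ω in B, ENNReal.ofReal (W (n + 1) ω) ∂P ≤ ∫⁻ ω in B, ENNReal.ofReal (W n ω) ∂P) :
    ∀ᵐ ω ∂P, ∃ l, Tendsto (fun n => W n ω) atTop (𝓝 l) := by
  have hWm : ∀ n, Measurable (W n) := fun n => (hW n).mono (ℱ.le n) le_rfl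
  have hfin : ∀ n, ∫⁻ ω, ENNReal.ofReal (W n ω) ∂P ≤ ∫⁻ ω, ENNReal.ofReal (W 0 ω) ∂P := by
    intro n
    induction n with
    | zero => rfl
    | succ n ih => simpa using (hle n Set.univ MeasurableSet.univ).trans (by simpa using ih)
  have h0 : ∫⁻ ω, ENNReal.ofReal (W 0 ω) ∂P < ∞ := hint.lintegral_lt_top
  have hI : ∀ n, Integrable (W n) P := fun n =>
    (lintegral_ofReal_ne_top_iff_integrable (hWm n).aestronglyMeasurable
      (ae_of_all _ (hW0 n))).1 ((hfin n).trans_lt h0).ne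
  have hsuper : Supermartingale W ℱ P := by
    refine supermartingale_of_setIntegral_succ_le (fun n => (hW n).stronglyMeasurable) hI
      fun n B hB => ?_
    rw [integral_eq_lintegral_of_nonneg_ae (ae_of_all _ (hW0 _))
        (hWm _).aestronglyMeasurable,
      integral_eq_lintegral_of_nonneg_ae (ae_of_all _ (hW0 _)) (hWm _).aestronglyMeasurable]
    refine ENNReal.toReal_mono ?_ (hle n B hB)
    exact ((setLIntegral_le_lintegral _ _).trans_lt ((hfin n).trans_lt h0)).ne
  have hbdd : ∀ n, eLpNorm ((-W) n) 1 P ≤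
      ((∫⁻ ω, ENNReal.ofReal (W 0 ω) ∂P).toNNReal : ℝ≥0∞) := by
    intro n
    rw [ENNReal.coe_toNNReal h0.ne, eLpNorm_one_eq_lintegral_enorm]
    refine le_trans (le_of_eq ?_) (hfin n)
    refine lintegral_congr fun ω => ?_
    rw [Pi.neg_apply, Pi.neg_apply, enorm_neg, Real.enorm_of_nonneg (hW0 n ω)]
  filter_upwards [hsuper.neg.ae_tendsto_limitProcess hbdd] with ω hω
  exact ⟨_, by simpa using hω.neg⟩

section DataStream

variable {Ω Ξ : Type*} [MeasurableSpace Ξ] {mΩ : MeasurableSpace Ω} {P : Measure Ω}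
  {ℱ : Filtration ℕ mΩ} {ν : Measure Ξ} {ξ : ℕ → Ω → Ξ}

theorem IsDataStream.measurable (h : IsDataStream P ℱ ν ξ) (t : ℕ) : Measurable (ξ (t + 1)) :=
  (h.adapted t).mono (ℱ.le _) le_rfl

theorem IsDataStream.isProbabilityMeasure [IsProbabilityMeasure P] (h : IsDataStream P ℱ ν ξ) :
    IsProbabilityMeasure ν := by
  rw [← h.law 0]
  exact Measure.isProbabilityMeasure_map (h.measurable 0).aemeasurable

/-- Conditionally on the past `ℱ t`, the variable `ξ (t + 1)` has law `ν`. -/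
theorem IsDataStream.lintegral_mul_comp [IsProbabilityMeasure P] {E : Type*} [MeasurableSpace E]
    (h : IsDataStream P ℱ ν ξ) (t : ℕ) {X : Ω → E} (hX : Measurable[ℱ t] X) {U : Ω → ℝ≥0∞}
    (hU : Measurable[ℱ t] U) {φ : E × Ξ → ℝ≥0∞} (hφ : Measurable φ) :
    ∫⁻ ω, U ω * φ (X ω, ξ (t + 1) ω) ∂P = ∫⁻ ω, U ω * ∫⁻ z, φ (X ω, z) ∂ν ∂P := by
  rw [lintegral_mul_comp_eq_of_indep (ℱ.le t) (h.measurable t) (h.indep t) hX hU hφ, h.law t]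

theorem IsDataStream.setLIntegral_comp [IsProbabilityMeasure P] {E : Type*} [MeasurableSpace E]
    (h : IsDataStream P ℱ ν ξ) (t : ℕ) {X : Ω → E} (hX : Measurable[ℱ t] X) {B : Set Ω}
    (hB : MeasurableSet[ℱ t] B) {φ : E × Ξ → ℝ≥0∞} (hφ : Measurable φ) :
    ∫⁻ ω in B, φ (X ω, ξ (t + 1) ω) ∂P = ∫⁻ ω in B, ∫⁻ z, φ (X ω, z) ∂ν ∂P := by
  have h1 := h.lintegral_mul_comp t hX (U := B.indicator fun _ => 1)
    (measurable_const.indicator hB) hφ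
  have hB' := ℱ.le t B hB
  rw [← lintegral_indicator hB', ← lintegral_indicator hB']
  convert h1 using 2
  · ext ω
    by_cases hω : ω ∈ B <;> simp [hω]
  · ext ω
    by_cases hω : ω ∈ B <;> simp [hω]

theorem IsDataStream.lintegral_comp (h : IsDataStream P ℱ ν ξ) (t : ℕ) {φ : Ξ → ℝ≥0∞}
    (hφ : Measurable φ) : ∫⁻ ω, φ (ξ (t + 1) ω) ∂P = ∫⁻ z, φ z ∂ν := by
  rw [← h.law t, lintegral_map hφ (h.measurable t)]

theorem IsDataStream.integral_comp (h : IsDataStream P ℱ ν ξ) (t : ℕ) {φ : Ξ → ℝ}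
    (hφ : Measurable φ) : ∫ ω, φ (ξ (t + 1) ω) ∂P = ∫ z, φ z ∂ν := by
  rw [← h.law t, integral_map (h.measurable t).aemeasurable hφ.aestronglyMeasurable]

theorem IsDataStream.memLp_comp (h : IsDataStream P ℱ ν ξ) (t : ℕ) {E : Type*}
    [NormedAddCommGroup E] {φ : Ξ → E} {q : ℝ≥0∞} (hφ : MemLp φ q ν) :
    MemLp (fun ω => φ (ξ (t + 1) ω)) q P := by
  rw [← h.law t] at hφ
  exact hφ.comp_of_map (h.measurable t).aemeasurable

theorem IsDataStream.condExp_comp [IsProbabilityMeasure P]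
    (h : IsDataStream P ℱ ν ξ) (t : ℕ) {φ : Ξ → ℝ}
    (hφ : Measurable φ) :
    P[fun ω => φ (ξ (t + 1) ω) | ℱ t] =ᵐ[P] fun _ => ∫ z, φ z ∂ν := by
  have h1 : StronglyMeasurable[MeasurableSpace.comap (ξ (t + 1)) inferInstance]
      (fun ω => φ (ξ (t + 1) ω)) :=
    (hφ.comp (comap_measurable (ξ (t + 1)))).stronglyMeasurable
  refine (condExp_indep_eq (h.measurable t).comap_le (ℱ.le t) h1 (h.indep t)).trans ?_
  rw [h.integral_comp t hφ]

theorem IsDataStream.indepFun (h : IsDataStream P ℱ ν ξ) {i j : ℕ} (hij : i ≠ j) :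
    IndepFun (ξ (i + 1)) (ξ (j + 1)) P := by
  wlog hlt : i < j generalizing i j
  · exact (this hij.symm (lt_of_le_of_ne (not_lt.1 hlt) hij.symm)).symm
  refine IndepFun.symm ?_
  rw [IndepFun_iff_Indep]
  exact indep_of_indep_of_le_right (h.indep j)
    (((h.adapted i).mono (ℱ.mono hlt) le_rfl).comap_le)

/-- Sums of independent centred variables with summable variances are almost surely bounded. -/
theorem IsDataStream.ae_bounded_sum_of_summable_sq [IsProbabilityMeasure P]
    (h : IsDataStream P ℱ ν ξ) {f : ℕ → Ξ → ℝ}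
    (hf : ∀ j, Measurable (f j)) (hL2 : ∀ j, MemLp (f j) 2 ν) (hmean : ∀ j, ∫ z, f j z ∂ν = 0)
    (hsum : Summable fun j => ∫ z, f j z ^ 2 ∂ν) :
    ∀ᵐ ω ∂P, ∃ K : ℝ, ∀ n, |∑ j ∈ Finset.range n, f j (ξ (j + 1) ω)| ≤ K := by
  set X : ℕ → Ω → ℝ := fun j ω => f j (ξ (j + 1) ω) with hX
  set M : ℕ → Ω → ℝ := fun n ω => ∑ j ∈ Finset.range n, X j ω with hM
  have hXm : ∀ j, Measurable (X j) := fun j => (hf j).comp (h.measurable j)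
  have hXL2 : ∀ j, MemLp (X j) 2 P := fun j => h.memLp_comp j (hL2 j)
  have hML2 : ∀ n, MemLp (M n) 2 P := fun n => memLp_finsetSum _ fun j _ => hXL2 j
  have hMint : ∀ n, Integrable (M n) P := fun n => (hML2 n).integrable (by norm_num)
  have hadp : StronglyAdapted ℱ M := by
    intro n
    refine Measurable.stronglyMeasurable ?_
    refine Finset.measurable_sum _ fun j hj => ?_
    exact (hf j).comp ((h.adapted j).mono (ℱ.mono (Finset.mem_range.1 hj)) le_rfl)
  have hmart : Martingale M ℱ P := by
    refine martingale_of_condExp_sub_eq_zero_nat hadp hMint fun n => ?_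
    have e : M (n + 1) - M n = fun ω => f n (ξ (n + 1) ω) := by
      ext ω; simp [hM, hX, Finset.sum_range_succ]
    rw [e]
    refine (h.condExp_comp n (hf n)).trans ?_
    rw [hmean n]; rfl
  have hmeanX : ∀ j, ∫ ω, X j ω ∂P = 0 := fun j => by rw [hX, h.integral_comp j (hf j), hmean j]
  have hmeanM : ∀ n, ∫ ω, M n ω ∂P = 0 := fun n => by
    simp only [hM]
    rw [integral_finsetSum _ fun j _ => (hXL2 j).integrable (by norm_num)]
    exact Finset.sum_eq_zero fun j _ => hmeanX j
  have hvarX : ∀ j, variance (X j) P = ∫ z, f j z ^ 2 ∂ν := fun j => by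
    rw [variance_of_integral_eq_zero (hXm j).aemeasurable (hmeanX j)]
    exact h.integral_comp j ((hf j).pow_const 2)
  have hsq : ∀ n, ∫ ω, M n ω ^ 2 ∂P ≤ ∑' j, ∫ z, f j z ^ 2 ∂ν := fun n => by
    rw [← variance_of_integral_eq_zero (hML2 n).aestronglyMeasurable.aemeasurable (hmeanM n)]
    have e : M n = ∑ j ∈ Finset.range n, X j := by ext ω; simp [hM]
    rw [e, IndepFun.variance_sum (fun j _ => hXL2 j)]
    · simp_rw [hvarX]
      exact hsum.sum_le_tsum _ fun j _ => integral_nonneg fun z => sq_nonneg _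
    · intro i _ j _ hij
      exact (h.indepFun hij).comp (hf i) (hf j)
  have hbdd : ∀ n, eLpNorm (M n) 1 P ≤ ((1 + ∑' j, ∫ z, f j z ^ 2 ∂ν).toNNReal : ℝ≥0∞) := by
    intro n
    rw [eLpNorm_one_eq_lintegral_enorm, ← ofReal_integral_norm_eq_lintegral_enorm (hMint n)]
    refine ENNReal.ofReal_le_ofReal ?_
    have hi := (hML2 n).integrable_sq
    calc ∫ ω, ‖M n ω‖ ∂P ≤ ∫ ω, (1 + M n ω ^ 2) ∂P := by
          refine integral_mono (hMint n).norm ((integrable_const 1).add hi) fun ω => ?_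
          simp only [Real.norm_eq_abs]
          nlinarith [sq_nonneg (|M n ω| - 1), sq_abs (M n ω), abs_nonneg (M n ω)]
      _ = 1 + ∫ ω, M n ω ^ 2 ∂P := by
          rw [integral_add (integrable_const 1) hi]; simp
      _ ≤ _ := by linarith [hsq n]
  filter_upwards [hmart.submartingale.ae_tendsto_limitProcess hbdd] with ω hω
  obtain ⟨K, hK⟩ := hω.norm.bddAbove_range
  exact ⟨K, fun n => hK ⟨n, rfl⟩⟩

/-- Marcinkiewicz–Zygmund: for centred `f ∈ L^q`, `1 ≤ q ≤ 2`, and `∑ c_j^{-q} < ∞`, the sums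
`∑ f(ξ_{j+1}) / c_j` are almost surely bounded. -/
theorem IsDataStream.ae_bounded_sum_div_of_memLp [IsProbabilityMeasure P]
    (h : IsDataStream P ℱ ν ξ) {f : Ξ → ℝ} {q : ℝ}
    (hq1 : 1 ≤ q) (hq2 : q ≤ 2) (hf : Measurable f) (hLq : MemLp f (ENNReal.ofReal q) ν)
    (hmean : ∫ z, f z ∂ν = 0) {c : ℕ → ℝ} (hc : ∀ j, 0 < c j)
    (hsum : Summable fun j => c j ^ (-q)) :
    ∀ᵐ ω ∂P, ∃ K : ℝ, ∀ n, |∑ j ∈ Finset.range n, f (ξ (j + 1) ω) / c j| ≤ K := by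
  have := h.isProbabilityMeasure
  have hq0 : 0 < q := by linarith
  set g : ℕ → Ξ → ℝ := fun j z => if |f z| ≤ c j then f z / c j else 0 with hg
  set r : ℕ → Ξ → ℝ := fun j z => if |f z| ≤ c j then 0 else f z / c j with hr
  have hdec : ∀ j z, f z / c j = g j z + r j z := fun j z => by
    simp only [hg, hr]; split_ifs <;> simp
  have hset : ∀ j, MeasurableSet {z | |f z| ≤ c j} := fun j =>
    measurableSet_le (by fun_prop) measurable_const
  have hgm : ∀ j, Measurable (g j) := fun j =>
    Measurable.ite (hset j) (hf.div_const _) measurable_const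
  have hrm : ∀ j, Measurable (r j) := fun j =>
    Measurable.ite (hset j) measurable_const (hf.div_const _)
  have hfi : Integrable f ν := hLq.integrable (by simpa using ENNReal.ofReal_le_ofReal hq1)
  have hqi : Integrable (fun z => |f z| ^ q) ν := by
    have := hLq.integrable_norm_rpow (by simpa using hq0) ENNReal.ofReal_ne_top
    simpa [ENNReal.toReal_ofReal hq0.le] using this
  set A := ∫ z, |f z| ^ q ∂ν with hA
  have hscale : ∀ j z, |f z / c j| ^ q = |f z| ^ q * c j ^ (-q) := fun j z => by
    rw [abs_div, abs_of_pos (hc j), Real.div_rpow (abs_nonneg _) (hc j).le,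
      Real.rpow_neg (hc j).le, div_eq_mul_inv]
  have hqi' : ∀ j, Integrable (fun z => |f z| ^ q * c j ^ (-q)) ν := fun j => hqi.mul_const _
  have hgle : ∀ j z, |g j z| ≤ 1 := fun j z => by
    simp only [hg]
    split_ifs with hz
    · rw [abs_div, abs_of_pos (hc j)]; exact div_le_one_of_le₀ hz (hc j).le
    · simp
  have hgsq : ∀ j z, g j z ^ 2 ≤ |f z| ^ q * c j ^ (-q) := fun j z => by
    rw [← hscale]
    have hle := hgle j z
    simp only [hg] at hle ⊢
    split_ifs at hle ⊢ with hz
    · rw [← sq_abs, ← Real.rpow_two]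
      exact Real.rpow_le_rpow_of_exponent_ge_of_imp (abs_nonneg _) hle hq2 (by
        intro _ h0; linarith)
    · simpa using Real.rpow_nonneg (abs_nonneg _) _
  have hrle : ∀ j z, |r j z| ≤ |f z| ^ q * c j ^ (-q) := fun j z => by
    rw [← hscale]
    simp only [hr]
    split_ifs with hz
    · simpa using Real.rpow_nonneg (abs_nonneg _) _
    · have h1 : 1 ≤ |f z / c j| := by
        rw [abs_div, abs_of_pos (hc j), one_le_div (hc j)]; exact (not_le.1 hz).le
      conv_lhs => rw [← Real.rpow_one |f z / c j|]
      exact Real.rpow_le_rpow_of_exponent_le h1 hq1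
  have hgL2 : ∀ j, MemLp (g j) 2 ν := fun j =>
    MemLp.of_bound (hgm j).aestronglyMeasurable 1 (ae_of_all _ (hgle j))
  have hgi : ∀ j, Integrable (g j) ν := fun j => (hgL2 j).integrable (by norm_num)
  have hri : ∀ j, Integrable (r j) ν := fun j =>
    (hqi' j).mono' (hrm j).aestronglyMeasurable (ae_of_all _ (hrle j))
  set m : ℕ → ℝ := fun j => ∫ z, g j z ∂ν with hm
  have hmr : ∀ j, m j = - ∫ z, r j z ∂ν := fun j => by
    have e : ∫ z, f z / c j ∂ν = m j + ∫ z, r j z ∂ν := by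
      rw [hm, ← integral_add (hgi j) (hri j)]
      exact integral_congr_ae (ae_of_all _ (hdec j))
    rw [integral_div, hmean, zero_div] at e
    linarith
  have hrA : ∀ j, ∫ z, |r j z| ∂ν ≤ A * c j ^ (-q) := fun j => by
    rw [hA, ← integral_mul_const]
    exact integral_mono (hri j).abs (hqi' j) (hrle j)
  have hmA : ∀ j, |m j| ≤ A * c j ^ (-q) := fun j => by
    rw [hmr, abs_neg]
    exact abs_integral_le_integral_abs.trans (hrA j)
  have hsA : Summable fun j => A * c j ^ (-q) := hsum.mul_left A
  have hfjm : ∀ j, Measurable fun z => g j z - m j := fun j => (hgm j).sub_const _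
  have hfjL2 : ∀ j, MemLp (fun z => g j z - m j) 2 ν := fun j => (hgL2 j).sub (memLp_const _)
  have hfj0 : ∀ j, ∫ z, (g j z - m j) ∂ν = 0 := fun j => by
    rw [integral_sub (hgi j) (integrable_const _)]; simp [hm]
  have hfjsq : ∀ j, ∫ z, (g j z - m j) ^ 2 ∂ν ≤ A * c j ^ (-q) := fun j => by
    have h1 : variance (g j) ν = ∫ z, (g j z - m j) ^ 2 ∂ν :=
      variance_eq_integral (hgm j).aemeasurable
    have h2 : variance (g j) ν ≤ ∫ z, g j z ^ 2 ∂ν :=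
      variance_le_expectation_sq (hgm j).aestronglyMeasurable
    rw [← h1, hA, ← integral_mul_const]
    exact h2.trans (integral_mono (hgL2 j).integrable_sq (hqi' j) (hgsq j))
  have hM := h.ae_bounded_sum_of_summable_sq hfjm hfjL2 hfj0
    (Summable.of_nonneg_of_le (fun j => integral_nonneg fun z => sq_nonneg _) hfjsq hsA)
  have hR : ∀ᵐ ω ∂P, Summable fun j => |r j (ξ (j + 1) ω)| := by
    refine ae_summable_of_lintegral_le (fun j => ((hrm j).comp (h.measurable j)).abs)
      (fun j ω => abs_nonneg _) hsA fun j => ?_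
    rw [h.lintegral_comp j (φ := fun z => ENNReal.ofReal |r j z|) (by fun_prop),
      ← ofReal_integral_eq_lintegral_ofReal (hri j).abs (ae_of_all _ fun z => abs_nonneg _)]
    exact ENNReal.ofReal_le_ofReal (hrA j)
  filter_upwards [hM, hR] with ω ⟨K, hK⟩ hRω
  refine ⟨K + ∑' j, A * c j ^ (-q) + ∑' j, |r j (ξ (j + 1) ω)|, fun n => ?_⟩
  have e : ∑ j ∈ Finset.range n, f (ξ (j + 1) ω) / c j =
      ∑ j ∈ Finset.range n, (g j (ξ (j + 1) ω) - m j) + ∑ j ∈ Finset.range n, m j +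
        ∑ j ∈ Finset.range n, r j (ξ (j + 1) ω) := by
    rw [← Finset.sum_add_distrib, ← Finset.sum_add_distrib]
    exact Finset.sum_congr rfl fun j _ => by rw [hdec]; ring
  rw [e]
  refine (abs_add_three _ _ _).trans (add_le_add (add_le_add (hK n) ?_) ?_)
  · refine (Finset.abs_sum_le_sum_abs _ _).trans ((Finset.sum_le_sum fun j _ => hmA j).trans ?_)
    exact hsA.sum_le_tsum _ fun j _ => (abs_nonneg _).trans (hmA j)
  · exact (Finset.abs_sum_le_sum_abs _ _).trans (hRω.sum_le_tsum _ fun j _ => abs_nonneg _)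

end DataStream

/-! ### Random fields that are Lipschitz in `L²` -/

theorem lintegral_enorm_le_of_eLpNorm_two_le {Ξ E : Type*} [MeasurableSpace Ξ]
    [NormedAddCommGroup E] {ν : Measure Ξ} [IsProbabilityMeasure ν] {f : Ξ → E} {r : ℝ≥0∞}
    (hf : AEStronglyMeasurable f ν) (h : eLpNorm f 2 ν ≤ r) : ∫⁻ z, ‖f z‖ₑ ∂ν ≤ r := by
  rw [← eLpNorm_one_eq_lintegral_enorm]
  exact (eLpNorm_le_eLpNorm_of_exponent_le (by norm_num) hf).trans h

theorem lintegral_enorm_sq_eq_eLpNorm_two_sq {Ξ E : Type*} [MeasurableSpace Ξ]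
    [NormedAddCommGroup E] {ν : Measure Ξ} (f : Ξ → E) :
    ∫⁻ z, ‖f z‖ₑ ^ 2 ∂ν = eLpNorm f 2 ν ^ 2 := by
  have := eLpNorm_nnreal_pow_eq_lintegral (μ := ν) (f := f) (p := 2) (by norm_num)
  simpa using this.symm

section Field

variable {d : ℕ} {Ξ : Type*} [MeasurableSpace Ξ] {ν : Measure Ξ}
  {G : Vec d → Ξ → Vec d} {xs : Vec d} {L : ℝ}

theorem measurable_section {Ξ E F : Type*} [MeasurableSpace Ξ] [MeasurableSpace E]
    [MeasurableSpace F] {G : E → Ξ → F} (hG : Measurable fun q : E × Ξ => G q.1 q.2) (x : E) :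
    Measurable (G x) :=
  hG.comp measurable_prodMk_left

theorem memLp_two_of_lipschitz (hG : Measurable fun q : Vec d × Ξ => G q.1 q.2)
    (hL : ∀ x y, eLpNorm (fun z => G x z - G y z) 2 ν ≤ ENNReal.ofReal (L * ‖x - y‖))
    (hxs : MemLp (G xs) 2 ν) (x : Vec d) : MemLp (G x) 2 ν := by
  have h1 : MemLp (fun z => G x z - G xs z) 2 ν :=
    ⟨((measurable_section hG x).sub (measurable_section hG xs)).aestronglyMeasurable,
      (hL x xs).trans_lt ENNReal.ofReal_lt_top⟩
  refine (h1.add hxs).ae_eq (ae_of_all _ fun z => ?_)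
  simp

theorem integral_norm_sub_sq_le (hL0 : 0 ≤ L) (hG : Measurable fun q : Vec d × Ξ => G q.1 q.2)
    (hL : ∀ x y, eLpNorm (fun z => G x z - G y z) 2 ν ≤ ENNReal.ofReal (L * ‖x - y‖))
    (x y : Vec d) : ∫ z, ‖G x z - G y z‖ ^ 2 ∂ν ≤ L ^ 2 * ‖x - y‖ ^ 2 := by
  have hm : Measurable fun z => ‖G x z - G y z‖ ^ 2 :=
    ((measurable_section hG x).sub (measurable_section hG y)).norm.pow_const 2
  rw [integral_eq_lintegral_of_nonneg_ae (ae_of_all _ fun z => sq_nonneg _)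
    hm.aestronglyMeasurable]
  refine ENNReal.toReal_le_of_le_ofReal (by positivity) ?_
  have e : ∀ z, ENNReal.ofReal (‖G x z - G y z‖ ^ 2) = ‖G x z - G y z‖ₑ ^ 2 := fun z => by
    rw [ENNReal.ofReal_pow (norm_nonneg _), ofReal_norm]
  simp_rw [e]
  rw [lintegral_enorm_sq_eq_eLpNorm_two_sq, ← mul_pow, ENNReal.ofReal_pow (by positivity)]
  gcongr
  exact hL x y

theorem norm_meanField_sub_le [IsProbabilityMeasure ν] (hL0 : 0 ≤ L)
    (hG : Measurable fun q : Vec d × Ξ => G q.1 q.2)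
    (hL : ∀ x y, eLpNorm (fun z => G x z - G y z) 2 ν ≤ ENNReal.ofReal (L * ‖x - y‖))
    (hxs : MemLp (G xs) 2 ν) (x y : Vec d) :
    ‖meanField G ν x - meanField G ν y‖ ≤ L * ‖x - y‖ := by
  have hi : ∀ x, Integrable (G x) ν := fun x =>
    (memLp_two_of_lipschitz hG hL hxs x).integrable (by norm_num)
  unfold meanField
  rw [← integral_sub (hi x) (hi y)]
  have h1 := enorm_integral_le_lintegral_enorm (μ := ν) (fun z => G x z - G y z)
  have h2 := h1.trans (lintegral_enorm_le_of_eLpNorm_two_le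
    ((measurable_section hG x).sub (measurable_section hG y)).aestronglyMeasurable (hL x y))
  rw [← ofReal_norm] at h2
  exact (ENNReal.ofReal_le_ofReal_iff (by positivity)).1 h2

theorem integral_norm_sq_le [IsProbabilityMeasure ν] (hL0 : 0 ≤ L)
    (hG : Measurable fun q : Vec d × Ξ => G q.1 q.2)
    (hL : ∀ x y, eLpNorm (fun z => G x z - G y z) 2 ν ≤ ENNReal.ofReal (L * ‖x - y‖))
    (hxs : MemLp (G xs) 2 ν) (x : Vec d) :
    ∫ z, ‖G x z‖ ^ 2 ∂ν ≤ 2 * L ^ 2 * ‖x - xs‖ ^ 2 + 2 * ∫ z, ‖G xs z‖ ^ 2 ∂ν := by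
  have hx := memLp_two_of_lipschitz hG hL hxs x
  have h1 : Integrable (fun z => ‖G x z - G xs z‖ ^ 2) ν := (hx.sub hxs).norm.integrable_sq
  have h2 : Integrable (fun z => ‖G xs z‖ ^ 2) ν := hxs.norm.integrable_sq
  calc ∫ z, ‖G x z‖ ^ 2 ∂ν ≤ ∫ z, (2 * ‖G x z - G xs z‖ ^ 2 + 2 * ‖G xs z‖ ^ 2) ∂ν := by
        refine integral_mono hx.norm.integrable_sq ((h1.const_mul 2).add (h2.const_mul 2))
          fun z => ?_
        have h3 : ‖G x z‖ ≤ ‖G x z - G xs z‖ + ‖G xs z‖ := by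
          simpa using norm_add_le (G x z - G xs z) (G xs z)
        simp only
        nlinarith [norm_nonneg (G x z), sq_nonneg (‖G x z - G xs z‖ - ‖G xs z‖)]
    _ = 2 * (∫ z, ‖G x z - G xs z‖ ^ 2 ∂ν) + 2 * ∫ z, ‖G xs z‖ ^ 2 ∂ν := by
        rw [integral_add (h1.const_mul 2) (h2.const_mul 2), integral_const_mul,
          integral_const_mul]
    _ ≤ _ := by
        have := integral_norm_sub_sq_le hL0 hG hL x xs
        linarith

end Field

/-! ### Drift functions -/

/-- A function `v` with minimum `0` at `x*`, growing at least quadratically, and decreasing on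
average by `η D(x)` up to `O(η²)` in a step `x ↦ x - η G(x, ξ)`. -/
structure IsDrift {d : ℕ} {Ξ : Type*} [MeasurableSpace Ξ] (G : Vec d → Ξ → Vec d) (ν : Measure Ξ)
    (xs : Vec d) (v D : Vec d → ℝ) (μ C : ℝ) : Prop where
  continuous_v : Continuous v
  continuous_D : Continuous D
  mu_pos : 0 < μ
  C_nonneg : 0 ≤ C
  quad : ∀ x, μ * ‖x - xs‖ ^ 2 ≤ v x
  v_root : v xs = 0
  D_nonneg : ∀ x, 0 ≤ D x
  D_pos : ∀ x, x ≠ xs → 0 < D x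
  step : ∀ η : ℝ, 0 ≤ η → ∀ x,
    ∫⁻ z, ENNReal.ofReal (v (x - η • G x z)) ∂ν + ENNReal.ofReal (η * D x) ≤
      ENNReal.ofReal (v x + C * η ^ 2 * (1 + v x))

theorem IsDrift.v_nonneg {d : ℕ} {Ξ : Type*} [MeasurableSpace Ξ] {G : Vec d → Ξ → Vec d}
    {ν : Measure Ξ} {xs : Vec d} {v D : Vec d → ℝ} {μ C : ℝ} (h : IsDrift G ν xs v D μ C)
    (x : Vec d) : 0 ≤ v x :=
  (mul_nonneg h.mu_pos.le (sq_nonneg _)).trans (h.quad x)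

theorem inner_gradient_eq_fderiv {d : ℕ} {V : Vec d → ℝ} (y h : Vec d) :
    inner ℝ (gradient V y) h = fderiv ℝ V y h := by
  unfold gradient
  rw [InnerProductSpace.toDual_symm_apply]

theorem le_add_inner_gradient_of_lipschitz {d : ℕ} {V : Vec d → ℝ} {LV : ℝ}
    (hV : Differentiable ℝ V) (hLV : 0 ≤ LV)
    (hLip : ∀ y z, ‖gradient V y - gradient V z‖ ≤ LV * ‖y - z‖) (y h : Vec d) :
    V (y + h) ≤ V y + inner ℝ (gradient V y) h + LV * ‖h‖ ^ 2 := by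
  have hf : ∀ u w, ‖fderiv ℝ V u - fderiv ℝ V w‖ ≤ LV * ‖u - w‖ := by
    intro u w
    have := hLip u w
    unfold gradient at this
    rwa [← map_sub, LinearIsometryEquiv.norm_map] at this
  have hmem : y + h ∈ Metric.closedBall y ‖h‖ := by simp
  have hy : y ∈ Metric.closedBall y ‖h‖ := by simp
  have h1 := (convex_closedBall y ‖h‖).norm_image_sub_le_of_norm_fderiv_le' (𝕜 := ℝ)
    (f := V) (φ := fderiv ℝ V y) (C := LV * ‖h‖) (fun u _ => hV u) (fun u hu => (hf u y).trans (by
      gcongr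
      simpa [dist_eq_norm] using hu)) hy hmem
  rw [add_sub_cancel_left] at h1
  have h2 := (le_abs_self _).trans h1
  rw [inner_gradient_eq_fderiv]
  nlinarith

/-- The Lyapunov condition yields a drift function with exponential decay near `x*`. -/
theorem LyapunovCondition.exists_isDrift {d : ℕ} {Ξ : Type*} [MeasurableSpace Ξ] {ν : Measure Ξ}
    [IsProbabilityMeasure ν] {G : Vec d → Ξ → Vec d} {xs : Vec d}
    (h : LyapunovCondition (meanField G ν) xs)
    (hG : Measurable fun q : Vec d × Ξ => G q.1 q.2) (hroot : meanField G ν xs = 0)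
    (hLip : LipschitzL2 G ν) (hxs : MemLp (G xs) 2 ν) :
    ∃ (v D : Vec d → ℝ) (μ C : ℝ), IsDrift G ν xs v D μ C ∧
      ∃ δ lamV : ℝ, 0 < δ ∧ 0 < lamV ∧ ∀ x, ‖x - xs‖ ≤ δ → lamV * v x ≤ D x := by
  obtain ⟨V, δV, μV, LV, lamV, hδ, hμ, hLV, hlam, hdiff, hV0, hquad, hgrad, hpos, hloc⟩ := h
  obtain ⟨L, hL0, hL⟩ := hLip
  set g := meanField G ν with hg
  have hgcont : Continuous g := by
    refine (LipschitzWith.of_dist_le_mul (K := ⟨L, hL0.le⟩) fun x y => ?_).continuous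
    rw [dist_eq_norm, dist_eq_norm]
    exact norm_meanField_sub_le hL0.le hG hL hxs x y
  have hgradcont : Continuous (gradient V) := by
    refine (LipschitzWith.of_dist_le_mul (K := ⟨LV, hLV.le⟩) fun x y => ?_).continuous
    rw [dist_eq_norm, dist_eq_norm]
    exact hgrad x y
  set M := ∫ z, ‖G xs z‖ ^ 2 ∂ν with hM
  have hM0 : 0 ≤ M := integral_nonneg fun z => sq_nonneg _
  have hVnn : ∀ y, 0 ≤ V y := fun y => by
    have := hquad (y + xs)
    rw [add_sub_cancel_right] at this
    exact (mul_nonneg hμ.le (sq_nonneg _)).trans this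
  set D : Vec d → ℝ := fun x => inner ℝ (gradient V (x - xs)) (g x) with hD
  have hDnn : ∀ x, 0 ≤ D x := fun x => by
    by_cases hx : x = xs
    · simp [hD, hx, hroot]
    · exact (hpos x hx).le
  set C := LV * (2 * L ^ 2 / μV + 2 * M) with hC
  have hC0 : 0 ≤ C := by positivity
  refine ⟨fun x => V (x - xs), D, μV, C, ⟨?_, ?_, hμ, hC0, hquad, by simp [hV0], hDnn,
    hpos, ?_⟩, δV, lamV, hδ, hlam, hloc⟩
  · exact hdiff.continuous.comp (continuous_id.sub continuous_const)
  · exact (hgradcont.comp (continuous_id.sub continuous_const)).inner hgcont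
  · intro η hη x
    have hx := memLp_two_of_lipschitz hG hL hxs x
    have hi : Integrable (G x) ν := hx.integrable (by norm_num)
    have hsq : Integrable (fun z => ‖G x z‖ ^ 2) ν := hx.norm.integrable_sq
    set y := x - xs with hy
    set b : Ξ → ℝ := fun z => V y - η * inner ℝ (gradient V y) (G x z) +
      LV * η ^ 2 * ‖G x z‖ ^ 2 with hb
    have hin : Integrable (fun z => inner ℝ (gradient V y) (G x z)) ν := hi.const_inner _
    have hVb : ∀ z, V (x - η • G x z - xs) ≤ b z := fun z => by
      have h1 := le_add_inner_gradient_of_lipschitz hdiff hLV.le hgrad y (-(η • G x z))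
      have e : x - η • G x z - xs = y + -(η • G x z) := by rw [hy]; abel
      rw [e]
      refine h1.trans (le_of_eq ?_)
      rw [inner_neg_right, inner_smul_right, norm_neg, norm_smul, mul_pow, Real.norm_eq_abs,
        sq_abs]
      simp only [hb]; ring
    have hsub : Integrable (fun z => V y - η * inner ℝ (gradient V y) (G x z)) ν :=
      (integrable_const _).sub (hin.const_mul η)
    have hbi : Integrable b ν := hsub.add (hsq.const_mul _)
    have hb0 : ∀ z, 0 ≤ b z := fun z => (hVnn _).trans (hVb z)
    have hbint : ∫ z, b z ∂ν = V y - η * D x + LV * η ^ 2 * ∫ z, ‖G x z‖ ^ 2 ∂ν := by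
      simp only [hb]
      rw [integral_add hsub (hsq.const_mul _),
        integral_sub (integrable_const _) (hin.const_mul η), integral_const_mul,
        integral_const_mul, integral_inner hi]
      simp [hD, hg, hy, meanField]
    have h1 : ∫⁻ z, ENNReal.ofReal (V (x - η • G x z - xs)) ∂ν ≤
        ENNReal.ofReal (∫ z, b z ∂ν) := by
      rw [ofReal_integral_eq_lintegral_ofReal hbi (ae_of_all _ hb0)]
      exact lintegral_mono fun z => ENNReal.ofReal_le_ofReal (hVb z)
    refine (add_le_add_left h1 _).trans ?_
    rw [← ENNReal.ofReal_add (integral_nonneg hb0) (mul_nonneg hη (hDnn x))]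
    refine ENNReal.ofReal_le_ofReal ?_
    rw [hbint]
    have h2 := integral_norm_sq_le hL0.le hG hL hxs x
    have h3 : ‖x - xs‖ ^ 2 ≤ V y / μV := by
      rw [le_div_iff₀ hμ, mul_comm]; exact hquad x
    have h4 : ∫ z, ‖G x z‖ ^ 2 ∂ν ≤ (2 * L ^ 2 / μV + 2 * M) * (1 + V y) := by
      have : 2 * L ^ 2 * ‖x - xs‖ ^ 2 ≤ 2 * L ^ 2 * (V y / μV) := by gcongr
      have e : 2 * L ^ 2 * (V y / μV) = 2 * L ^ 2 / μV * V y := by ring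
      have h5 : 0 ≤ 2 * L ^ 2 / μV := by positivity
      nlinarith [hVnn y, mul_nonneg hM0 (hVnn y)]
    have h5 : LV * η ^ 2 * ∫ z, ‖G x z‖ ^ 2 ∂ν ≤
        LV * η ^ 2 * ((2 * L ^ 2 / μV + 2 * M) * (1 + V y)) := by gcongr
    rw [hC]
    nlinarith

/-! ### Step sizes and iterates -/

theorem stepSize_nonneg {η₀ a : ℝ} (hη₀ : 0 < η₀) (t : ℕ) : 0 ≤ stepSize η₀ a t := by
  unfold stepSize
  split_ifs <;> positivity

theorem stepSize_of_pos {η₀ a : ℝ} {t : ℕ} (ht : 1 ≤ t) :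
    stepSize η₀ a t = η₀ * (t : ℝ) ^ (-a) := by
  unfold stepSize
  rw [if_neg (by omega)]

theorem summable_stepSize_sq {η₀ a : ℝ} (ha : 1 / 2 < a) :
    Summable fun t => stepSize η₀ a t ^ 2 := by
  rw [← summable_nat_add_iff 1]
  have h : Summable fun t : ℕ => (t : ℝ) ^ (-(2 * a)) :=
    Real.summable_nat_rpow.2 (by linarith)
  refine (((summable_nat_add_iff 1).2 h).mul_left (η₀ ^ 2)).congr fun t => ?_
  rw [stepSize_of_pos (by omega), mul_pow, ← Real.rpow_natCast (((t + 1 : ℕ) : ℝ) ^ (-a)),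
    ← Real.rpow_mul (by positivity)]
  congr 2
  push_cast; ring

theorem not_summable_stepSize {η₀ a : ℝ} (hη₀ : 0 < η₀) (ha : a < 1) :
    ¬ Summable fun t => stepSize η₀ a t := by
  intro h
  have h1 : Summable fun t : ℕ => (t : ℝ) ^ (-a) := by
    rw [← summable_nat_add_iff 1] at h ⊢
    refine (h.mul_left η₀⁻¹).congr fun t => ?_
    rw [stepSize_of_pos (by omega)]
    field_simp
  have := Real.summable_nat_rpow.1 h1
  linarith

section Iterate

variable {d : ℕ} {Ω Ξ : Type*} [MeasurableSpace Ξ] {mΩ : MeasurableSpace Ω} {P : Measure Ω}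
  {ℱ : Filtration ℕ mΩ} {ν : Measure Ξ} {ξ : ℕ → Ω → Ξ}
  {G : Vec d → Ξ → Vec d} {x₀ : Ω → Vec d} {xs : Vec d} {η : ℕ → ℝ}
  {v D : Vec d → ℝ} {μ C : ℝ}

theorem measurable_iterate (hξ : IsDataStream P ℱ ν ξ)
    (hG : Measurable fun q : Vec d × Ξ => G q.1 q.2) (hx₀ : Measurable[ℱ 0] x₀) (t : ℕ) :
    Measurable[ℱ t] (iterate G η ξ x₀ t) := by
  induction t with
  | zero => exact hx₀
  | succ t ih =>
    have h1 : Measurable[ℱ (t + 1)] (iterate G η ξ x₀ t) := ih.mono (ℱ.mono t.le_succ) le_rfl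
    have h2 : Measurable[ℱ (t + 1)] fun ω => G (iterate G η ξ x₀ t ω) (ξ (t + 1) ω) :=
      hG.comp (h1.prodMk (hξ.adapted t))
    exact h1.sub (h2.const_smul (η t))

/-- If `α_n (v(y_n) + 1) + ∑_{s<n} α_{s+1} η_s D(y_s)` converges, then `y_n → x*`. -/
theorem IsDrift.tendsto_of_tendsto (h : IsDrift G ν xs v D μ C) {α : ℕ → ℝ} {α₀ : ℝ}
    (hα₀ : 0 < α₀) (hα : Tendsto α atTop (𝓝 α₀)) (hαle : ∀ n, α₀ ≤ α n) (hη : ∀ n, 0 ≤ η n)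
    (hdiv : ¬ Summable η) {y : ℕ → Vec d} {l : ℝ}
    (hl : Tendsto (fun n => α n * (v (y n) + 1) +
      ∑ s ∈ Finset.range n, α (s + 1) * η s * D (y s)) atTop (𝓝 l)) :
    Tendsto y atTop (𝓝 xs) := by
  have hαp : ∀ n, 0 < α n := fun n => hα₀.trans_le (hαle n)
  have hterm : ∀ s, 0 ≤ α (s + 1) * η s * D (y s) := fun s =>
    mul_nonneg (mul_nonneg (hαp _).le (hη s)) (h.D_nonneg _)
  obtain ⟨K, hK⟩ := hl.bddAbove_range
  have hsum : Summable fun s => α (s + 1) * η s * D (y s) := by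
    refine summable_of_sum_range_le (c := K) hterm fun n => ?_
    have h1 := hK ⟨n, rfl⟩
    have h2 : 0 ≤ α n * (v (y n) + 1) :=
      mul_nonneg (hαp n).le (by linarith [h.v_nonneg (y n)])
    simp only at h1
    linarith
  have hsum' : Summable fun s => η s * D (y s) := by
    refine Summable.of_nonneg_of_le (fun s => mul_nonneg (hη s) (h.D_nonneg _)) (fun s => ?_)
      (hsum.mul_left α₀⁻¹)
    rw [← div_eq_inv_mul, le_div_iff₀ hα₀]
    have := mul_le_mul_of_nonneg_right (hαle (s + 1)) (mul_nonneg (hη s) (h.D_nonneg (y s)))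
    linarith
  obtain ⟨w, hw⟩ : ∃ w, Tendsto (fun n => v (y n)) atTop (𝓝 w) := by
    have h1 := hl.sub hsum.hasSum.tendsto_sum_nat
    have h2 := h1.div hα hα₀.ne'
    refine ⟨_, (h2.sub_const 1).congr fun n => ?_⟩
    have := (hαp n).ne'
    rw [Pi.div_apply, add_sub_cancel_right, mul_div_cancel_left₀ _ this, add_sub_cancel_right]
  have hw0 : 0 ≤ w := ge_of_tendsto' hw fun n => h.v_nonneg _
  have hwz : w = 0 := by
    by_contra hne
    have hwpos : 0 < w := lt_of_le_of_ne hw0 (Ne.symm hne)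
    set S := {x : Vec d | w / 2 ≤ v x ∧ v x ≤ 2 * w} with hS
    have hSclosed : IsClosed S :=
      (isClosed_le continuous_const h.continuous_v).inter
        (isClosed_le h.continuous_v continuous_const)
    have hScomp : IsCompact S := by
      refine Metric.isCompact_of_isClosed_isBounded hSclosed ?_
      refine (Metric.isBounded_closedBall (x := xs) (r := 1 + 2 * w / μ)).subset fun x hx => ?_
      rw [Metric.mem_closedBall, dist_eq_norm]
      have h1 : ‖x - xs‖ ^ 2 ≤ 2 * w / μ := by
        rw [le_div_iff₀ h.mu_pos, mul_comm]; exact (h.quad x).trans hx.2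
      nlinarith [sq_nonneg (‖x - xs‖ - 1), norm_nonneg (x - xs)]
    have hev : ∀ᶠ n in atTop, y n ∈ S :=
      (hw.eventually (le_mem_nhds (by linarith : w / 2 < w))).and
        (hw.eventually (ge_mem_nhds (by linarith : w < 2 * w)))
    obtain ⟨N, hN⟩ := eventually_atTop.1 hev
    obtain ⟨z, hzS, hz⟩ := hScomp.exists_isMinOn ⟨y N, hN N le_rfl⟩ h.continuous_D.continuousOn
    have hDz : 0 < D z := h.D_pos z fun e => by
      have := hzS.1
      rw [e, h.v_root] at this
      linarith
    refine hdiv ?_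
    rw [← summable_nat_add_iff N] at hsum' ⊢
    refine Summable.of_nonneg_of_le (fun s => hη _) (fun s => ?_) (hsum'.mul_left (D z)⁻¹)
    rw [← div_eq_inv_mul, le_div_iff₀ hDz]
    exact mul_le_mul_of_nonneg_left (hz (hN (s + N) (by omega))) (hη _)
  rw [hwz] at hw
  rw [tendsto_iff_norm_sub_tendsto_zero]
  have h1 : Tendsto (fun n => ‖y n - xs‖ ^ 2) atTop (𝓝 0) := by
    refine squeeze_zero (fun n => sq_nonneg _) (fun n => ?_) (by simpa using hw.div_const μ)
    rw [le_div_iff₀ h.mu_pos, mul_comm]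
    exact h.quad _
  have h2 := h1.sqrt
  simpa [Real.sqrt_sq (norm_nonneg _)] using h2

/-- The iterates converge almost surely (Robbins–Siegmund argument). -/
theorem IsDrift.ae_tendsto_iterate [IsProbabilityMeasure P] (h : IsDrift G ν xs v D μ C)
    (hξ : IsDataStream P ℱ ν ξ) (hG : Measurable fun q : Vec d × Ξ => G q.1 q.2)
    (hx₀ : Measurable[ℱ 0] x₀) (hη : ∀ n, 0 ≤ η n) (hsq : Summable fun n => η n ^ 2)
    (hdiv : ¬ Summable η) :
    ∀ᵐ ω ∂P, Tendsto (fun t => iterate G η ξ x₀ t ω) atTop (𝓝 xs) := by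
  set x := iterate G η ξ x₀ with hx
  have hxm : ∀ t, Measurable[ℱ t] (x t) := measurable_iterate hξ hG hx₀
  set α : ℕ → ℝ := fun n => Real.exp (-(C * ∑ s ∈ Finset.range n, η s ^ 2)) with hα
  set α₀ := Real.exp (-(C * ∑' s, η s ^ 2)) with hα₀
  have hαt : Tendsto α atTop (𝓝 α₀) :=
    (Real.continuous_exp.tendsto _).comp (hsq.hasSum.tendsto_sum_nat.const_mul C).neg
  have hαle : ∀ n, α₀ ≤ α n := fun n => by
    refine Real.exp_le_exp.2 (neg_le_neg (mul_le_mul_of_nonneg_left ?_ h.C_nonneg))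
    exact hsq.sum_le_tsum _ fun s _ => sq_nonneg _
  have hαp : ∀ n, 0 < α n := fun n => Real.exp_pos _
  have hαstep : ∀ n, α (n + 1) * (1 + C * η n ^ 2) ≤ α n := fun n => by
    have e : α n = α (n + 1) * Real.exp (C * η n ^ 2) := by
      simp only [hα]
      rw [← Real.exp_add, Finset.sum_range_succ]; congr 1; ring
    rw [e]
    refine mul_le_mul_of_nonneg_left ?_ (hαp _).le
    linarith [Real.add_one_le_exp (C * η n ^ 2)]
  set R : ℕ → Ω → ℝ := fun n ω => ∑ s ∈ Finset.range n, α (s + 1) * η s * D (x s ω) with hR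
  have hR0 : ∀ n ω, 0 ≤ R n ω := fun n ω => Finset.sum_nonneg fun s _ =>
    mul_nonneg (mul_nonneg (hαp _).le (hη s)) (h.D_nonneg _)
  have hRm : ∀ n, Measurable[ℱ n] (R n) := fun n => by
    refine Finset.measurable_sum _ fun s hs => ?_
    have h1 : Measurable[ℱ n] (x s) :=
      (hxm s).mono (ℱ.mono (Finset.mem_range.1 hs).le) le_rfl
    exact (h.continuous_D.measurable.comp h1).const_mul _
  have main : ∀ K : ℕ, ∀ᵐ ω ∂P, v (x₀ ω) ≤ K → Tendsto (fun t => x t ω) atTop (𝓝 xs) := by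
    intro K
    set A := {ω | v (x₀ ω) ≤ K} with hA
    have hAm : MeasurableSet[ℱ 0] A :=
      measurableSet_le (h.continuous_v.measurable.comp hx₀) measurable_const
    set c : Ω → ℝ := A.indicator fun _ => 1 with hc
    have hc0 : ∀ ω, 0 ≤ c ω := fun ω => Set.indicator_nonneg (fun _ _ => zero_le_one) ω
    have hcm : ∀ n, Measurable[ℱ n] c := fun n =>
      measurable_const.indicator (ℱ.mono (Nat.zero_le n) _ hAm)
    set W : ℕ → Ω → ℝ := fun n ω => c ω * (α n * (v (x n ω) + 1) + R n ω) with hW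
    have hW0 : ∀ n ω, 0 ≤ W n ω := fun n ω => mul_nonneg (hc0 ω) (add_nonneg
      (mul_nonneg (hαp n).le (by linarith [h.v_nonneg (x n ω)])) (hR0 n ω))
    have hWm : ∀ n, Measurable[ℱ n] (W n) := fun n =>
      (hcm n).mul ((((h.continuous_v.measurable.comp (hxm n)).add_const 1).const_mul _).add
        (hRm n))
    have hWint : Integrable (W 0) P := by
      refine Integrable.of_bound ((hWm 0).mono (ℱ.le 0) le_rfl).aestronglyMeasurable
        ((K : ℝ) + 1) (ae_of_all _ fun ω => ?_)
      rw [Real.norm_of_nonneg (hW0 0 ω)]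
      by_cases hω : ω ∈ A
      · have h1 : v (x₀ ω) ≤ K := hω
        simpa [hW, hc, hω, hα, hR, hx, iterate] using h1
      · simp [hW, hc, hω]; positivity
    have hle : ∀ n, ∀ B, MeasurableSet[ℱ n] B →
        ∫⁻ ω in B, ENNReal.ofReal (W (n + 1) ω) ∂P ≤ ∫⁻ ω in B, ENNReal.ofReal (W n ω) ∂P := by
      intro n B hB
      set X : Ω → Vec d × ℝ × ℝ := fun ω => (x n ω, c ω, R n ω) with hX
      have hXm : Measurable[ℱ n] X := (hxm n).prodMk ((hcm n).prodMk (hRm n))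
      set φ : (Vec d × ℝ × ℝ) × Ξ → ℝ≥0∞ := fun q => ENNReal.ofReal (q.1.2.1 *
        (α (n + 1) * (v (q.1.1 - η n • G q.1.1 q.2) + 1) +
          (q.1.2.2 + α (n + 1) * η n * D q.1.1))) with hφ
      have hφm : Measurable φ := by
        have h1 : Measurable fun q : (Vec d × ℝ × ℝ) × Ξ => G q.1.1 q.2 :=
          hG.comp (measurable_fst.fst.prodMk measurable_snd)
        have h2 : Measurable fun q : (Vec d × ℝ × ℝ) × Ξ => v (q.1.1 - η n • G q.1.1 q.2) :=
          h.continuous_v.measurable.comp (measurable_fst.fst.sub (h1.const_smul (η n)))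
        have h3 : Measurable fun q : (Vec d × ℝ × ℝ) × Ξ => D q.1.1 :=
          h.continuous_D.measurable.comp measurable_fst.fst
        exact (measurable_fst.snd.fst.mul (((h2.add_const 1).const_mul _).add
          (measurable_fst.snd.snd.add (h3.const_mul _)))).ennreal_ofReal
      have e1 : ∀ ω, ENNReal.ofReal (W (n + 1) ω) = φ (X ω, ξ (n + 1) ω) := fun ω => by
        simp only [hW, hφ, hX, hR, Finset.sum_range_succ]
        rfl
      simp_rw [e1]
      rw [hξ.setLIntegral_comp n hXm hB hφm]
      refine lintegral_mono fun ω => ?_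
      have hDn := mul_nonneg (hη n) (h.D_nonneg (x n ω))
      have hcα : 0 ≤ c ω * α (n + 1) := mul_nonneg (hc0 ω) (hαp _).le
      have hrest : 0 ≤ c ω * (α (n + 1) + R n ω) :=
        mul_nonneg (hc0 ω) (add_nonneg (hαp _).le (hR0 n ω))
      have e2 : ∀ z, φ (X ω, z) = ENNReal.ofReal (c ω * α (n + 1)) *
          (ENNReal.ofReal (v (x n ω - η n • G (x n ω) z)) + ENNReal.ofReal (η n * D (x n ω))) +
            ENNReal.ofReal (c ω * (α (n + 1) + R n ω)) := fun z => by
        rw [← ENNReal.ofReal_add (h.v_nonneg _) hDn, ← ENNReal.ofReal_mul hcα,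
          ← ENNReal.ofReal_add (mul_nonneg hcα (add_nonneg (h.v_nonneg _) hDn)) hrest]
        simp only [hφ, hX]
        congr 1; ring
      have hprob := hξ.isProbabilityMeasure
      have hvm : Measurable fun z => ENNReal.ofReal (v (x n ω - η n • G (x n ω) z)) :=
        (h.continuous_v.measurable.comp (measurable_const.sub
          ((measurable_section hG (x n ω)).const_smul (η n)))).ennreal_ofReal
      simp_rw [e2]
      rw [lintegral_add_right _ measurable_const, lintegral_const_mul _ (hvm.add_const _),
        lintegral_add_right _ measurable_const, lintegral_const, lintegral_const, measure_univ,
        mul_one, mul_one]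
      refine (add_le_add_left (mul_le_mul_right (h.step (η n) (hη n) (x n ω)) _) _).trans ?_
      have hv := h.v_nonneg (x n ω)
      have hC := h.C_nonneg
      rw [← ENNReal.ofReal_mul hcα, ← ENNReal.ofReal_add (by positivity) hrest]
      refine ENNReal.ofReal_le_ofReal ?_
      have e3 : c ω * α (n + 1) * (v (x n ω) + C * η n ^ 2 * (1 + v (x n ω))) +
          c ω * (α (n + 1) + R n ω) =
          c ω * (α (n + 1) * (1 + C * η n ^ 2) * (v (x n ω) + 1) + R n ω) := by ring
      rw [e3]
      refine mul_le_mul_of_nonneg_left ?_ (hc0 ω)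
      gcongr
      exact hαstep n
    filter_upwards [ae_tendsto_of_nonneg_supermartingale hWm hW0 hWint hle] with ω ⟨l, hl⟩ hω
    have hcω : c ω = 1 := Set.indicator_of_mem (show ω ∈ A from hω) _
    simp only [hW, hcω, one_mul] at hl
    exact h.tendsto_of_tendsto (Real.exp_pos _) hαt hαle hη hdiv hl
  filter_upwards [ae_all_iff.2 main] with ω hω
  obtain ⟨K, hK⟩ := exists_nat_ge (v (x₀ ω))
  exact hω K hK

/-- The event that the process stays within distance `δ` of `x*` at the times `N, …, j`. -/
def stayEvent (x : ℕ → Ω → Vec d) (xs : Vec d) (δ : ℝ) (N j : ℕ) : Set Ω :=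
  {ω | ∀ i, N ≤ i → i ≤ j → ‖x i ω - xs‖ ≤ δ}

theorem measurableSet_stayEvent {x : ℕ → Ω → Vec d} (hx : ∀ t, Measurable[ℱ t] (x t))
    (δ : ℝ) (N j : ℕ) : MeasurableSet[ℱ j] (stayEvent x xs δ N j) := by
  have e : stayEvent x xs δ N j = ⋂ i ∈ Finset.Icc N j, {ω | ‖x i ω - xs‖ ≤ δ} := by
    ext ω; simp [stayEvent]
  rw [e]
  refine Finset.measurableSet_biInter _ fun i hi => ?_
  have h1 : Measurable[ℱ j] (x i) :=
    (hx i).mono (ℱ.mono (Finset.mem_Icc.1 hi).2) le_rfl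
  have h2 : Measurable fun y : Vec d => ‖y - xs‖ := by fun_prop
  exact measurableSet_le (h2.comp h1) measurable_const

/-- On the event of staying near `x*`, the drift function decays like the step size. -/
theorem IsDrift.setLIntegral_stayEvent_le [IsProbabilityMeasure P] {η₀ a : ℝ}
    (h : IsDrift G ν xs v D μ C) (hξ : IsDataStream P ℱ ν ξ)
    (hG : Measurable fun q : Vec d × Ξ => G q.1 q.2) (hx₀ : Measurable[ℱ 0] x₀)
    (hη₀ : 0 < η₀) (ha : 0 < a) (ha' : a < 1) {δ lamV : ℝ} (hlam : 0 < lamV)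
    (hloc : ∀ x, ‖x - xs‖ ≤ δ → lamV * v x ≤ D x) (N : ℕ) :
    ∃ K : ℝ, ∀ᶠ j : ℕ in atTop,
      ∫⁻ ω in stayEvent (iterate G (stepSize η₀ a) ξ x₀) xs δ N j,
        ENNReal.ofReal (v (iterate G (stepSize η₀ a) ξ x₀ j ω)) ∂P ≤
        ENNReal.ofReal (K * (j : ℝ) ^ (-a)) := by
  set x := iterate G (stepSize η₀ a) ξ x₀ with hx
  set B := stayEvent x xs δ N with hB
  have hxm : ∀ t, Measurable[ℱ t] (x t) := measurable_iterate hξ hG hx₀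
  have hBm : ∀ j, MeasurableSet[ℱ j] (B j) := measurableSet_stayEvent hxm δ N
  have hBanti : ∀ j, B (j + 1) ⊆ B j := fun j ω hω i h1 h2 => hω i h1 (by omega)
  have hvm : ∀ j, Measurable fun ω => ENNReal.ofReal (v (x j ω)) := fun j =>
    (h.continuous_v.measurable.comp ((hxm j).mono (ℱ.le j) le_rfl)).ennreal_ofReal
  obtain ⟨M, hM⟩ : ∃ M, ∀ y, ‖y - xs‖ ≤ δ → v y ≤ M := by
    obtain ⟨M, hM⟩ := (isCompact_closedBall xs δ).bddAbove_image h.continuous_v.continuousOn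
    exact ⟨M, fun y hy => hM ⟨y, by simpa [dist_eq_norm] using hy, rfl⟩⟩
  set I : ℕ → ℝ≥0∞ := fun j => ∫⁻ ω in B j, ENNReal.ofReal (v (x j ω)) ∂P with hI
  have hbd : ∀ j, N ≤ j → ∀ ω ∈ B j, ‖x j ω - xs‖ ≤ δ := fun j hj ω hω => hω j hj le_rfl
  have hIfin : ∀ j, N ≤ j → I j ≠ ∞ := fun j hj => by
    have h1 : I j ≤ ∫⁻ _ in B j, ENNReal.ofReal M ∂P :=
      setLIntegral_mono' (ℱ.le j _ (hBm j)) fun ω hω =>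
        ENNReal.ofReal_le_ofReal (hM _ (hbd j hj ω hω))
    refine (h1.trans_lt ?_).ne
    rw [setLIntegral_const]
    exact ENNReal.mul_lt_top ENNReal.ofReal_lt_top (measure_lt_top _ _)
  set c := lamV * η₀ with hc
  set C' := C * η₀ ^ 2 * (1 + |M|) with hC'
  have hrec : ∀ᶠ j : ℕ in atTop, (I (j + 1)).toReal ≤
      (1 - c * (j : ℝ) ^ (-a)) * (I j).toReal + C' * ((j : ℝ) ^ (-a)) ^ 2 := by
    filter_upwards [eventually_ge_atTop N, eventually_ge_atTop 1] with j hjN hj1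
    set s := stepSize η₀ a j with hs
    have hs0 : 0 ≤ s := stepSize_nonneg hη₀ j
    have hCnn := h.C_nonneg
    have hBm' := ℱ.le j _ (hBm j)
    have h1 : I (j + 1) + ENNReal.ofReal (s * lamV) * I j ≤
        I j + ENNReal.ofReal (C * s ^ 2 * (1 + |M|)) := by
      calc I (j + 1) + ENNReal.ofReal (s * lamV) * I j
          ≤ ∫⁻ ω in B j, ENNReal.ofReal (v (x (j + 1) ω)) ∂P +
              ∫⁻ ω in B j, ENNReal.ofReal (s * D (x j ω)) ∂P := by
            refine add_le_add (lintegral_mono_set (hBanti j)) ?_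
            rw [hI, ← lintegral_const_mul _ (hvm j)]
            refine setLIntegral_mono' hBm' fun ω hω => ?_
            rw [← ENNReal.ofReal_mul (by positivity)]
            refine ENNReal.ofReal_le_ofReal ?_
            rw [mul_assoc]
            exact mul_le_mul_of_nonneg_left (hloc _ (hbd j hjN ω hω)) hs0
        _ = ∫⁻ ω in B j, (∫⁻ z, ENNReal.ofReal (v (x j ω - s • G (x j ω) z)) ∂ν +
              ENNReal.ofReal (s * D (x j ω))) ∂P := by
            have hφ : Measurable fun q : Vec d × Ξ =>
                ENNReal.ofReal (v (q.1 - s • G q.1 q.2)) :=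
              (h.continuous_v.measurable.comp
                (measurable_fst.sub (hG.const_smul s))).ennreal_ofReal
            have h2 := hξ.setLIntegral_comp j (hxm j) (hBm j) hφ
            have hDm : Measurable fun ω => ENNReal.ofReal (s * D (x j ω)) :=
              ((h.continuous_D.measurable.comp
                ((hxm j).mono (ℱ.le j) le_rfl)).const_mul s).ennreal_ofReal
            rw [lintegral_add_right _ hDm]
            congr 1
        _ ≤ ∫⁻ ω in B j, (ENNReal.ofReal (v (x j ω)) +
              ENNReal.ofReal (C * s ^ 2 * (1 + |M|))) ∂P := by
            refine setLIntegral_mono' hBm' fun ω hω => (h.step s hs0 (x j ω)).trans ?_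
            have hvn := h.v_nonneg (x j ω)
            rw [← ENNReal.ofReal_add hvn (by positivity)]
            refine ENNReal.ofReal_le_ofReal ?_
            have h3 : v (x j ω) ≤ |M| := (hM _ (hbd j hjN ω hω)).trans (le_abs_self M)
            gcongr
        _ ≤ I j + ENNReal.ofReal (C * s ^ 2 * (1 + |M|)) := by
            rw [lintegral_add_right _ measurable_const, setLIntegral_const]
            gcongr
            exact mul_le_of_le_one_right' prob_le_one
    have h2 := ENNReal.toReal_mono
      (ENNReal.add_ne_top.2 ⟨hIfin j hjN, ENNReal.ofReal_ne_top⟩) h1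
    rw [ENNReal.toReal_add (hIfin (j + 1) (by omega))
        (ENNReal.mul_ne_top ENNReal.ofReal_ne_top (hIfin j hjN)),
      ENNReal.toReal_add (hIfin j hjN) ENNReal.ofReal_ne_top, ENNReal.toReal_mul,
      ENNReal.toReal_ofReal (by positivity), ENNReal.toReal_ofReal (by positivity), hs,
      stepSize_of_pos hj1] at h2
    rw [hc, hC']
    linarith
  obtain ⟨K, hK⟩ := eventually_le_rpow_of_recursion (u := fun j => (I j).toReal) ha ha'
    (show 0 < c from mul_pos hlam hη₀) hrec
  refine ⟨K, ?_⟩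
  filter_upwards [hK, eventually_ge_atTop N] with j hj hjN
  exact (ENNReal.le_ofReal_iff_toReal_le (hIfin j hjN) (ENNReal.toReal_nonneg.trans hj)).2 hj

theorem IsDrift.setLIntegral_norm_stayEvent_le [IsProbabilityMeasure P] {η₀ a : ℝ}
    (h : IsDrift G ν xs v D μ C) (hξ : IsDataStream P ℱ ν ξ)
    (hG : Measurable fun q : Vec d × Ξ => G q.1 q.2) (hx₀ : Measurable[ℱ 0] x₀)
    (hη₀ : 0 < η₀) (ha : 0 < a) (ha' : a < 1) {δ lamV : ℝ} (hlam : 0 < lamV)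
    (hloc : ∀ x, ‖x - xs‖ ≤ δ → lamV * v x ≤ D x) (N : ℕ) :
    ∃ K : ℝ, ∀ᶠ j : ℕ in atTop,
      ∫⁻ ω in stayEvent (iterate G (stepSize η₀ a) ξ x₀) xs δ N j,
        ENNReal.ofReal ‖iterate G (stepSize η₀ a) ξ x₀ j ω - xs‖ ∂P ≤
        ENNReal.ofReal (K * (j : ℝ) ^ (-(a / 2))) := by
  obtain ⟨K, hK⟩ := h.setLIntegral_stayEvent_le hξ hG hx₀ hη₀ ha ha' hlam hloc N
  set x := iterate G (stepSize η₀ a) ξ x₀ with hx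
  refine ⟨1 + |K| / μ, ?_⟩
  filter_upwards [hK, eventually_ge_atTop 1] with j hj hj1
  have hj0 : (0 : ℝ) < j := by exact_mod_cast hj1
  have hμ := h.mu_pos
  set y := (j : ℝ) ^ (-(a / 2)) with hy
  have hy0 : 0 < y := Real.rpow_pos_of_pos hj0 _
  have hyy : (j : ℝ) ^ (-a) = y * y := by
    rw [hy, ← Real.rpow_add hj0]; congr 1; ring
  have hvm : Measurable fun ω => ENNReal.ofReal (v (x j ω)) :=
    (h.continuous_v.measurable.comp
      ((measurable_iterate hξ hG hx₀ j).mono (ℱ.le j) le_rfl)).ennreal_ofReal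
  calc ∫⁻ ω in stayEvent x xs δ N j, ENNReal.ofReal ‖x j ω - xs‖ ∂P
      ≤ ∫⁻ ω in stayEvent x xs δ N j, (ENNReal.ofReal (1 / (y * μ)) * ENNReal.ofReal (v (x j ω)) +
          ENNReal.ofReal y) ∂P := by
        refine lintegral_mono fun ω => ?_
        rw [← ENNReal.ofReal_mul (by positivity),
          ← ENNReal.ofReal_add (mul_nonneg (by positivity) (h.v_nonneg _)) hy0.le]
        refine ENNReal.ofReal_le_ofReal ?_
        have h1 := h.quad (x j ω)
        set r := ‖x j ω - xs‖
        have h2 : r ^ 2 / y ≤ 1 / (y * μ) * v (x j ω) := by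
          rw [one_div_mul_eq_div, div_le_div_iff₀ hy0 (by positivity)]
          nlinarith
        have h3 : r ≤ r ^ 2 / y + y := by
          rw [← sub_le_iff_le_add, le_div_iff₀ hy0]
          nlinarith [sq_nonneg (r - y), norm_nonneg (x j ω - xs), sq_nonneg r, sq_nonneg y]
        linarith
    _ ≤ ENNReal.ofReal (1 / (y * μ)) * ENNReal.ofReal (|K| * (y * y)) + ENNReal.ofReal y := by
        rw [lintegral_add_right _ measurable_const, lintegral_const_mul _ hvm, setLIntegral_const,
          ← hyy]
        gcongr
        · exact hj.trans (ENNReal.ofReal_le_ofReal (by gcongr; exact le_abs_self K))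
        · exact mul_le_of_le_one_right' prob_le_one
    _ = ENNReal.ofReal ((1 + |K| / μ) * y) := by
        rw [← ENNReal.ofReal_mul (by positivity), ← ENNReal.ofReal_add (by positivity) hy0.le]
        congr 1
        field_simp
        ring

end Iterate

/-! ### Averages of random fields along the iterates -/

section Average

variable {d : ℕ} {Ω Ξ : Type*} [MeasurableSpace Ξ] {mΩ : MeasurableSpace Ω} {P : Measure Ω}
  [IsProbabilityMeasure P] {ℱ : Filtration ℕ mΩ} {ν : Measure Ξ} {ξ : ℕ → Ω → Ξ}
  {x : ℕ → Ω → Vec d} {xs : Vec d}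

/-- Replacing `x_j` by `x*` in a field that is locally Lipschitz in `L¹` costs a summable amount
after normalisation. -/
theorem ae_summable_field_sub_div (hξ : IsDataStream P ℱ ν ξ) (hx : ∀ t, Measurable[ℱ t] (x t))
    {F : Vec d → Ξ → ℝ} (hF : Measurable fun q : Vec d × Ξ => F q.1 q.2) {δ CF a : ℝ}
    (ha : 0 ≤ a) (hCF : 0 ≤ CF)
    (hloc : ∀ y, ‖y - xs‖ ≤ δ →
      ∫⁻ z, ENNReal.ofReal |F y z - F xs z| ∂ν ≤ ENNReal.ofReal (CF * ‖y - xs‖))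
    (hrate : ∀ N, ∃ K : ℝ, ∀ᶠ j : ℕ in atTop, ∫⁻ ω in stayEvent x xs δ N j,
        ENNReal.ofReal ‖x j ω - xs‖ ∂P ≤ ENNReal.ofReal (K * (j : ℝ) ^ (-(a / 2)))) (N : ℕ) :
    ∀ᵐ ω ∂P, (∀ j, N ≤ j → ‖x j ω - xs‖ ≤ δ) →
      Summable fun j =>
        |F (x j ω) (ξ (j + 1) ω) - F xs (ξ (j + 1) ω)| / logWeight (1 - a / 2) j := by
  obtain ⟨K, hK⟩ := hrate N
  obtain ⟨J, hJ⟩ := eventually_atTop.1 (hK.and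
    ((eventually_ge_atTop N).and (eventually_ge_atTop 1)))
  set w := logWeight (1 - a / 2) with hw
  have hwp : ∀ j, 0 < w j := logWeight_pos _
  set B := stayEvent x xs δ N with hB
  have hBm : ∀ j, MeasurableSet[ℱ j] (B j) := measurableSet_stayEvent hx δ N
  have hxm : ∀ j, Measurable (x j) := fun j => (hx j).mono (ℱ.le j) le_rfl
  set Z : ℕ → Ω → ℝ := fun j ω => |F (x j ω) (ξ (j + 1) ω) - F xs (ξ (j + 1) ω)| / w j with hZ
  have hZ0 : ∀ j ω, 0 ≤ Z j ω := fun j ω => div_nonneg (abs_nonneg _) (hwp j).le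
  have hZm : ∀ j, Measurable (Z j) := fun j =>
    ((hF.comp ((hxm j).prodMk (hξ.measurable j))).sub
      ((measurable_section hF xs).comp (hξ.measurable j))).abs.div_const _
  set e : ℕ → ℝ := fun j => CF * |K| * 2 ^ (a / 2) *
    (((j : ℝ) + 1) ^ ((1 - a / 2) - 1) / w j) with he
  have hes : Summable e := (summable_rpow_div_logWeight _).mul_left _
  have hle : ∀ j, J ≤ j →
      ∫⁻ ω, ENNReal.ofReal ((B j).indicator (Z j) ω) ∂P ≤ ENNReal.ofReal (e j) := by
    intro j hj
    obtain ⟨h1, h2, h3⟩ := hJ j hj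
    have hj0 : (0 : ℝ) < j := by exact_mod_cast h3
    have hBm' := ℱ.le j _ (hBm j)
    have e1 : ∀ ω, ENNReal.ofReal ((B j).indicator (Z j) ω) =
        (B j).indicator (fun ω => ENNReal.ofReal (Z j ω)) ω := fun ω => by
      by_cases hω : ω ∈ B j <;> simp [hω]
    simp_rw [e1]
    rw [lintegral_indicator hBm']
    have hφ : Measurable fun q : Vec d × Ξ => ENNReal.ofReal |F q.1 q.2 - F xs q.2| :=
      (hF.sub ((measurable_section hF xs).comp measurable_snd)).abs.ennreal_ofReal
    have e2 : ∀ ω, ENNReal.ofReal (Z j ω) = ENNReal.ofReal (w j)⁻¹ *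
        ENNReal.ofReal |F (x j ω) (ξ (j + 1) ω) - F xs (ξ (j + 1) ω)| := fun ω => by
      rw [← ENNReal.ofReal_mul (inv_nonneg.2 (hwp j).le)]
      simp only [hZ, div_eq_inv_mul]
    simp_rw [e2]
    rw [lintegral_const_mul' _ _ ENNReal.ofReal_ne_top,
      hξ.setLIntegral_comp j (hx j) (hBm j) hφ]
    have h4 : ∫⁻ ω in B j, ∫⁻ z, ENNReal.ofReal |F (x j ω) z - F xs z| ∂ν ∂P ≤
        ENNReal.ofReal CF * ENNReal.ofReal (|K| * (j : ℝ) ^ (-(a / 2))) := by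
      calc _ ≤ ∫⁻ ω in B j, ENNReal.ofReal CF * ENNReal.ofReal ‖x j ω - xs‖ ∂P := by
            refine setLIntegral_mono' hBm' fun ω hω => ?_
            rw [← ENNReal.ofReal_mul hCF]
            exact hloc _ (hω j h2 le_rfl)
        _ ≤ _ := by
            rw [lintegral_const_mul _ ((hxm j).sub_const xs).norm.ennreal_ofReal]
            gcongr
            exact h1.trans (ENNReal.ofReal_le_ofReal (by gcongr; exact le_abs_self K))
    refine (mul_le_mul_right h4 _).trans ?_
    rw [← ENNReal.ofReal_mul hCF, ← ENNReal.ofReal_mul (inv_nonneg.2 (hwp j).le)]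
    refine ENNReal.ofReal_le_ofReal ?_
    have h5 : (j : ℝ) ^ (-(a / 2)) ≤ 2 ^ (a / 2) * ((j : ℝ) + 1) ^ ((1 - a / 2) - 1) := by
      have h6 : (j : ℝ) ^ (-(a / 2)) = 2 ^ (a / 2) * (2 * (j : ℝ)) ^ (-(a / 2)) := by
        rw [Real.mul_rpow (by norm_num) hj0.le, ← mul_assoc, ← Real.rpow_add (by norm_num)]
        simp
      have h7 : (1 : ℝ) ≤ j := by exact_mod_cast h3
      rw [h6, show (1 - a / 2) - 1 = -(a / 2) by ring]
      refine mul_le_mul_of_nonneg_left ?_ (by positivity)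
      exact Real.rpow_le_rpow_of_nonpos (by positivity) (by linarith) (by linarith)
    have hwi := inv_nonneg.2 (hwp j).le
    calc (w j)⁻¹ * (CF * (|K| * (j : ℝ) ^ (-(a / 2))))
        ≤ (w j)⁻¹ * (CF * (|K| * (2 ^ (a / 2) * ((j : ℝ) + 1) ^ ((1 - a / 2) - 1)))) := by
          gcongr
      _ = e j := by simp only [he, div_eq_mul_inv]; ring
  have hsum := ae_summable_of_lintegral_le (P := P)
    (Y := fun j => (B (j + J)).indicator (Z (j + J)))
    (fun j => (hZm _).indicator (ℱ.le _ _ (hBm _)))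
    (fun j ω => Set.indicator_nonneg (fun ω _ => hZ0 _ ω) ω)
    ((summable_nat_add_iff J).2 hes) (fun j => hle (j + J) (by omega))
  filter_upwards [hsum] with ω hω hstay
  rw [← summable_nat_add_iff J]
  refine hω.congr fun j => ?_
  rw [Set.indicator_of_mem]
  exact fun i h1 _ => hstay i h1

/-- Rate of convergence of the averages of a random field along the iterates. -/
theorem ae_isLittleO_average_sub (hξ : IsDataStream P ℱ ν ξ) (hx : ∀ t, Measurable[ℱ t] (x t))
    (hlim : ∀ᵐ ω ∂P, Tendsto (fun t => x t ω) atTop (𝓝 xs))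
    {F : Vec d → Ξ → ℝ} (hF : Measurable fun q : Vec d × Ξ => F q.1 q.2) {δ CF a q r : ℝ}
    (hδ : 0 < δ) (ha : 0 ≤ a) (ha' : a ≤ 2) (hCF : 0 ≤ CF)
    (hloc : ∀ y, ‖y - xs‖ ≤ δ →
      ∫⁻ z, ENNReal.ofReal |F y z - F xs z| ∂ν ≤ ENNReal.ofReal (CF * ‖y - xs‖))
    (hrate : ∀ N, ∃ K : ℝ, ∀ᶠ j : ℕ in atTop, ∫⁻ ω in stayEvent x xs δ N j,
        ENNReal.ofReal ‖x j ω - xs‖ ∂P ≤ ENNReal.ofReal (K * (j : ℝ) ^ (-(a / 2))))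
    (hq1 : 1 ≤ q) (hq2 : q ≤ 2) (hLq : MemLp (F xs) (ENNReal.ofReal q) ν)
    (hrq : r ≤ 1 - 1 / q) (hra : r ≤ a / 2) :
    ∀ᵐ ω ∂P, (fun t : ℕ => (t : ℝ)⁻¹ * ∑ j ∈ Finset.range t, F (x j ω) (ξ (j + 1) ω) -
      ∫ z, F xs z ∂ν) =o[atTop] fun t : ℕ => (t : ℝ) ^ (-r) * Real.log t ^ 3 := by
  have := hξ.isProbabilityMeasure
  set m := ∫ z, F xs z ∂ν with hm
  have hi : Integrable (F xs) ν := hLq.integrable (by simpa using ENNReal.ofReal_le_ofReal hq1)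
  have hmean : ∫ z, (F xs z - m) ∂ν = 0 := by
    rw [integral_sub hi (integrable_const _)]; simp [hm]
  have hMZ := hξ.ae_bounded_sum_div_of_memLp hq1 hq2 ((measurable_section hF xs).sub_const m)
    (hLq.sub (memLp_const m)) hmean (logWeight_pos (1 / q)) (summable_logWeight_rpow_neg hq1)
  have hsum := ae_all_iff.2 (ae_summable_field_sub_div hξ hx hF ha hCF hloc hrate)
  have hO : ∀ {X : ℕ → ℝ} {s K : ℝ}, 0 ≤ s → r ≤ 1 - s →
      (∀ n, |∑ j ∈ Finset.range n, X j / logWeight s j| ≤ K) →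
      (fun t : ℕ => (t : ℝ)⁻¹ * ∑ j ∈ Finset.range t, X j) =o[atTop]
        fun t : ℕ => (t : ℝ) ^ (-r) * Real.log t ^ 3 := by
    intro X s K hs hrs hK
    refine IsBigO.trans_isLittleO (IsBigO.of_bound (2 * K) (Eventually.of_forall fun t => ?_))
      (logWeight_div_isLittleO hs hrs)
    have h1 := abs_sum_le_of_abs_sum_div_le (logWeight_pos s) (logWeight_mono hs) hK t
    rw [norm_mul, norm_mul, Real.norm_of_nonneg (logWeight_pos s t).le,
      Real.norm_eq_abs (∑ _ ∈ _, _),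
      mul_comm ‖(t : ℝ)⁻¹‖, ← mul_assoc]
    gcongr
  filter_upwards [hMZ, hsum, hlim] with ω ⟨K, hK⟩ hsω hlω
  obtain ⟨N, hN⟩ := eventually_atTop.1 (Metric.tendsto_nhds.1 hlω δ hδ)
  have hs := hsω N fun j hj => by
    rw [← dist_eq_norm]; exact (hN j hj).le
  set Y : ℕ → ℝ := fun j => F (x j ω) (ξ (j + 1) ω) - F xs (ξ (j + 1) ω) with hY
  have hKY : ∀ n, |∑ j ∈ Finset.range n, Y j / logWeight (1 - a / 2) j| ≤
      ∑' j, |Y j| / logWeight (1 - a / 2) j := fun n => by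
    refine (Finset.abs_sum_le_sum_abs _ _).trans ?_
    simp_rw [abs_div, abs_of_pos (logWeight_pos (1 - a / 2) _)]
    exact hs.sum_le_tsum _ fun j _ => div_nonneg (abs_nonneg _) (logWeight_pos _ _).le
  have h1 := hO (by positivity) hrq hK
  have h2 := hO (by linarith) (by linarith) hKY
  refine (h1.add h2).congr' ?_ EventuallyEq.rfl
  filter_upwards [eventually_ge_atTop 1] with t ht
  have ht0 : (t : ℝ) ≠ 0 := by positivity
  rw [← mul_add, ← Finset.sum_add_distrib]
  have e : ∀ j, F xs (ξ (j + 1) ω) - m + Y j = F (x j ω) (ξ (j + 1) ω) - m := fun j => by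
    simp only [hY]; ring
  simp_rw [e]
  rw [Finset.sum_sub_distrib, Finset.sum_const, Finset.card_range, nsmul_eq_mul, mul_sub,
    inv_mul_cancel_left₀ ht0]

end Average

/-! ### Identification of the limiting covariance -/

section Covariance

variable {d : ℕ} {Ω Ξ : Type*} [MeasurableSpace Ξ] {mΩ : MeasurableSpace Ω} {P : Measure Ω}
  [IsProbabilityMeasure P] {ℱ : Filtration ℕ mΩ} {ν : Measure Ξ} {ξ : ℕ → Ω → Ξ}
  {G : Vec d → Ξ → Vec d} {x : ℕ → Ω → Vec d} {xs : Vec d} {L : ℝ}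

theorem abs_mul_apply_sub_le {d : ℕ} (u w : Vec d) (i j : Fin d) {τ : ℝ} (hτ : 0 < τ) :
    |u i * u j - w i * w j| ≤ (1 + 1 / τ) * ‖u - w‖ ^ 2 + τ * ‖w‖ ^ 2 := by
  have hu : ∀ k, |u k - w k| ≤ ‖u - w‖ := fun k => by
    simpa using PiLp.norm_apply_le (u - w) k
  have hw : ∀ k, |w k| ≤ ‖w‖ := fun k => by simpa using PiLp.norm_apply_le w k
  have e : u i * u j - w i * w j =
      (u i - w i) * (u j - w j) + (u i - w i) * w j + w i * (u j - w j) := by ring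
  have h1 : |u i * u j - w i * w j| ≤ ‖u - w‖ * ‖u - w‖ + ‖u - w‖ * ‖w‖ + ‖w‖ * ‖u - w‖ := by
    rw [e]
    refine (abs_add_three _ _ _).trans ?_
    rw [abs_mul, abs_mul, abs_mul]
    gcongr <;> first | exact hu _ | exact hw _
  have h2 : 2 * ‖u - w‖ * ‖w‖ ≤ 1 / τ * ‖u - w‖ ^ 2 + τ * ‖w‖ ^ 2 := by
    have h3 : 1 / τ * ‖u - w‖ ^ 2 + τ * ‖w‖ ^ 2 - 2 * ‖u - w‖ * ‖w‖ =
        1 / τ * (‖u - w‖ - τ * ‖w‖) ^ 2 := by field_simp; ring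
    have : 0 ≤ 1 / τ * (‖u - w‖ - τ * ‖w‖) ^ 2 := by positivity
    linarith
  linarith

theorem measurableSet_norm_sub_le {m : MeasurableSpace Ω} {y : Ω → Vec d} (hy : Measurable[m] y)
    (xs : Vec d) (ρ : ℝ) : MeasurableSet[m] {ω | ‖y ω - xs‖ ≤ ρ} := by
  have hnm : Measurable fun y : Vec d => ‖y - xs‖ := by fun_prop
  exact measurableSet_le (hnm.comp hy) measurable_const

/-- Mean square difference of `G(x_t, ξ_{t+1})` and `G(x*, ξ_{t+1})` when `x_t` is near `x*`. -/
theorem setLIntegral_norm_field_sub_sq_le (hξ : IsDataStream P ℱ ν ξ)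
    (hx : ∀ t, Measurable[ℱ t] (x t)) (hG : Measurable fun q : Vec d × Ξ => G q.1 q.2)
    (hL0 : 0 ≤ L)
    (hL : ∀ x y, eLpNorm (fun z => G x z - G y z) 2 ν ≤ ENNReal.ofReal (L * ‖x - y‖))
    (hxs : MemLp (G xs) 2 ν) (t : ℕ) (ρ : ℝ) :
    ∫⁻ ω in {ω | ‖x t ω - xs‖ ≤ ρ},
      ENNReal.ofReal (‖G (x t ω) (ξ (t + 1) ω) - G xs (ξ (t + 1) ω)‖ ^ 2) ∂P ≤
      ENNReal.ofReal (L ^ 2 * ρ ^ 2) := by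
  have hBm := measurableSet_norm_sub_le (hx t) xs ρ
  have hφ : Measurable fun q : Vec d × Ξ => ENNReal.ofReal (‖G q.1 q.2 - G xs q.2‖ ^ 2) :=
    ((hG.sub ((measurable_section hG xs).comp measurable_snd)).norm.pow_const 2).ennreal_ofReal
  rw [hξ.setLIntegral_comp t (hx t) hBm hφ]
  refine (setLIntegral_mono' (ℱ.le t _ hBm) (g := fun _ => ENNReal.ofReal (L ^ 2 * ρ ^ 2))
    fun ω hω => ?_).trans ?_
  · have hi : Integrable (fun z => ‖G (x t ω) z - G xs z‖ ^ 2) ν :=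
      ((memLp_two_of_lipschitz hG hL hxs (x t ω)).sub hxs).norm.integrable_sq
    rw [← ofReal_integral_eq_lintegral_ofReal hi (ae_of_all _ fun z => sq_nonneg _)]
    refine ENNReal.ofReal_le_ofReal ((integral_norm_sub_sq_le hL0 hG hL _ _).trans ?_)
    have h1 : ‖x t ω - xs‖ ≤ ρ := hω
    gcongr
  · rw [setLIntegral_const]
    exact mul_le_of_le_one_right' prob_le_one

theorem setLIntegral_le_of_condExp_le {m : MeasurableSpace Ω} (hm : m ≤ mΩ) {f : Ω → ℝ}
    (hf : Integrable f P) (hf0 : ∀ ω, 0 ≤ f ω) {B : Set Ω} (hB : MeasurableSet[m] B) {θ : ℝ}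
    (hθ : 0 ≤ θ) (hle : ∀ᵐ ω ∂P, ω ∈ B → (P[f | m]) ω ≤ θ) :
    ∫⁻ ω in B, ENNReal.ofReal (f ω) ∂P ≤ ENNReal.ofReal θ := by
  rw [← ofReal_integral_eq_lintegral_ofReal hf.integrableOn (ae_of_all _ hf0)]
  refine ENNReal.ofReal_le_ofReal ?_
  rw [← setIntegral_condExp hm hf hB]
  calc ∫ ω in B, (P[f | m]) ω ∂P ≤ ∫ _ in B, θ ∂P :=
        setIntegral_mono_on_ae integrable_condExp.integrableOn
          (integrable_const θ).integrableOn (hm _ hB) hle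
    _ ≤ θ := by
        rw [setIntegral_const, smul_eq_mul]
        exact mul_le_of_le_one_left hθ measureReal_le_one

theorem norm_sub_sub_sq_le {E : Type*} [SeminormedAddCommGroup E] {u v w : E} {c : ℝ}
    (hu : ‖u‖ ≤ c) : ‖u - v - w‖ ^ 2 ≤ 3 * ‖w‖ ^ 2 + (3 * ‖v‖ ^ 2 + 3 * c ^ 2) := by
  have h1 : ‖u - v - w‖ ≤ c + ‖v‖ + ‖w‖ := by
    have h2 := norm_sub_le (u - v) w
    have h3 := norm_sub_le u v
    linarith
  have h4 : ‖u - v - w‖ ^ 2 ≤ (c + ‖v‖ + ‖w‖) ^ 2 := by gcongr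
  nlinarith [sq_nonneg (c - ‖v‖), sq_nonneg (c - ‖w‖), sq_nonneg (‖v‖ - ‖w‖)]

/-- Near `x*`, the noise `ε_{t+1}(0)` is close in mean square to `-G(x*, ξ_{t+1})`. -/
theorem setLIntegral_noise_add_sq_le (hξ : IsDataStream P ℱ ν ξ)
    (hx : ∀ t, Measurable[ℱ t] (x t)) (hG : Measurable fun q : Vec d × Ξ => G q.1 q.2)
    (hL0 : 0 ≤ L)
    (hL : ∀ x y, eLpNorm (fun z => G x z - G y z) 2 ν ≤ ENNReal.ofReal (L * ‖x - y‖))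
    (hxs : MemLp (G xs) 2 ν) (hroot : meanField G ν xs = 0) {t : ℕ} {e0 ζ : Ω → Vec d}
    (hζ : MemLp ζ 2 P) (hdec : ∀ᵐ ω ∂P, noise G ν ξ x t ω = e0 ω + ζ ω) {ρ θ : ℝ}
    (hθ : 0 ≤ θ)
    (hζle : ∀ᵐ ω ∂P, ‖x t ω - xs‖ ≤ ρ → (P[fun ω' => ‖ζ ω'‖ ^ 2 | ℱ t]) ω ≤ θ) :
    ∫⁻ ω in {ω | ‖x t ω - xs‖ ≤ ρ}, ENNReal.ofReal (‖e0 ω + G xs (ξ (t + 1) ω)‖ ^ 2) ∂P ≤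
      ENNReal.ofReal (6 * L ^ 2 * ρ ^ 2 + 3 * θ) := by
  have := hξ.isProbabilityMeasure
  have hBm := measurableSet_norm_sub_le (hx t) xs ρ
  have hZle := setLIntegral_norm_field_sub_sq_le hξ hx hG hL0 hL hxs t ρ
  have hζI := setLIntegral_le_of_condExp_le (ℱ.le t) hζ.norm.integrable_sq
    (fun ω => sq_nonneg ‖ζ ω‖) hBm hθ hζle
  generalize hB : {ω | ‖x t ω - xs‖ ≤ ρ} = B at *
  have hxm : Measurable (x t) := (hx t).mono (ℱ.le t) le_rfl
  have hZm : Measurable fun ω =>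
      ENNReal.ofReal (‖G (x t ω) (ξ (t + 1) ω) - G xs (ξ (t + 1) ω)‖ ^ 2) :=
    (((hG.comp (hxm.prodMk (hξ.measurable t))).sub
      ((measurable_section hG xs).comp (hξ.measurable t))).norm.pow_const 2).ennreal_ofReal
  calc ∫⁻ ω in B, ENNReal.ofReal (‖e0 ω + G xs (ξ (t + 1) ω)‖ ^ 2) ∂P
      ≤ ∫⁻ ω in B, (ENNReal.ofReal 3 * ENNReal.ofReal (‖ζ ω‖ ^ 2) +
          (ENNReal.ofReal 3 *
              ENNReal.ofReal (‖G (x t ω) (ξ (t + 1) ω) - G xs (ξ (t + 1) ω)‖ ^ 2) +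
            ENNReal.ofReal (3 * (L * ρ) ^ 2))) ∂P := by
        refine setLIntegral_mono_ae' (ℱ.le t _ hBm) ?_
        filter_upwards [hdec] with ω hω hωB
        rw [← ENNReal.ofReal_mul (by norm_num), ← ENNReal.ofReal_mul (by norm_num),
          ← ENNReal.ofReal_add (by positivity) (by positivity),
          ← ENNReal.ofReal_add (by positivity) (by positivity)]
        refine ENNReal.ofReal_le_ofReal ?_
        have hg : ‖meanField G ν (x t ω)‖ ≤ L * ρ := by
          have h1 := norm_meanField_sub_le hL0 hG hL hxs (x t ω) xs
          rw [hroot, sub_zero] at h1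
          rw [← hB] at hωB
          exact h1.trans (mul_le_mul_of_nonneg_left hωB hL0)
        have h2 : e0 ω + G xs (ξ (t + 1) ω) = meanField G ν (x t ω) -
            (G (x t ω) (ξ (t + 1) ω) - G xs (ξ (t + 1) ω)) - ζ ω := by
          rw [eq_sub_of_add_eq hω.symm, noise]; abel
        rw [h2]
        exact norm_sub_sub_sq_le hg
    _ = ENNReal.ofReal 3 * ∫⁻ ω in B, ENNReal.ofReal (‖ζ ω‖ ^ 2) ∂P +
          (ENNReal.ofReal 3 * ∫⁻ ω in B,
              ENNReal.ofReal (‖G (x t ω) (ξ (t + 1) ω) - G xs (ξ (t + 1) ω)‖ ^ 2) ∂P +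
            ENNReal.ofReal (3 * (L * ρ) ^ 2) * P B) := by
        rw [lintegral_add_right _ ((hZm.const_mul _).add_const _),
          lintegral_add_right _ measurable_const, lintegral_const_mul _ hZm, setLIntegral_const,
          lintegral_const_mul' _ _ ENNReal.ofReal_ne_top]
    _ ≤ ENNReal.ofReal 3 * ENNReal.ofReal θ + (ENNReal.ofReal 3 * ENNReal.ofReal (L ^ 2 * ρ ^ 2) +
          ENNReal.ofReal (3 * (L * ρ) ^ 2)) := by
        gcongr
        exact mul_le_of_le_one_right' prob_le_one
    _ = ENNReal.ofReal (6 * L ^ 2 * ρ ^ 2 + 3 * θ) := by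
        rw [← ENNReal.ofReal_mul (by norm_num), ← ENNReal.ofReal_mul (by norm_num),
          ← ENNReal.ofReal_add (by positivity) (by positivity),
          ← ENNReal.ofReal_add (by positivity) (by positivity)]
        congr 1; ring

/-- Near `x*`, the conditional covariance of `ε_{t+1}(0)` is close to that of `G(x*, ξ)`. -/
theorem setIntegral_abs_condExp_sub_le (hξ : IsDataStream P ℱ ν ξ)
    (hx : ∀ t, Measurable[ℱ t] (x t)) (hG : Measurable fun q : Vec d × Ξ => G q.1 q.2)
    (hxs : MemLp (G xs) 2 ν) {t : ℕ} {e0 : Ω → Vec d} (he0 : MemLp e0 2 P) {ρ κ τ : ℝ}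
    (hκ : 0 ≤ κ) (hτ : 0 < τ)
    (hle : ∫⁻ ω in {ω | ‖x t ω - xs‖ ≤ ρ}, ENNReal.ofReal (‖e0 ω + G xs (ξ (t + 1) ω)‖ ^ 2) ∂P ≤
      ENNReal.ofReal κ) (i j : Fin d) :
    ∫ ω in {ω | ‖x t ω - xs‖ ≤ ρ}, |(P[fun ω => e0 ω i * e0 ω j | ℱ t]) ω -
      ∫ z, G xs z i * G xs z j ∂ν| ∂P ≤ (1 + 1 / τ) * κ + τ * ∫ z, ‖G xs z‖ ^ 2 ∂ν := by
  set B := {ω | ‖x t ω - xs‖ ≤ ρ} with hB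
  have hBm : MeasurableSet[ℱ t] B := measurableSet_norm_sub_le (hx t) xs ρ
  set e : Ω → Vec d := fun ω => -G xs (ξ (t + 1) ω) with he
  have heL : MemLp e 2 P := (hξ.memLp_comp t hxs).neg
  have hcoord : ∀ {f : Ω → Vec d}, MemLp f 2 P → ∀ k, MemLp (fun ω => f ω k) 2 P :=
    fun hf k => hf.of_le
      ((EuclideanSpace.proj k : Vec d →L[ℝ] ℝ).continuous.comp_aestronglyMeasurable
        hf.aestronglyMeasurable) (ae_of_all _ fun ω => PiLp.norm_apply_le _ k)
  have hi0 : Integrable (fun ω => e0 ω i * e0 ω j) P := (hcoord he0 i).integrable_mul (hcoord he0 j)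
  have hie : Integrable (fun ω => e ω i * e ω j) P := (hcoord heL i).integrable_mul (hcoord heL j)
  have hGm : Measurable fun z => G xs z i * G xs z j := by
    have h1 : ∀ k, Measurable fun z => G xs z k := fun k =>
      (EuclideanSpace.proj k : Vec d →L[ℝ] ℝ).continuous.measurable.comp (measurable_section hG xs)
    exact (h1 i).mul (h1 j)
  have hce : P[fun ω => e ω i * e ω j | ℱ t] =ᵐ[P] fun _ => ∫ z, G xs z i * G xs z j ∂ν := by
    refine EventuallyEq.trans ?_ (hξ.condExp_comp t hGm)
    refine condExp_congr_ae (ae_of_all _ fun ω => ?_)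
    simp [he]
  have hsub := condExp_sub hi0 hie (ℱ t)
  set f : Ω → ℝ := (fun ω => e0 ω i * e0 ω j) - fun ω => e ω i * e ω j with hf
  have hfi : Integrable f P := hi0.sub hie
  have e1 : ∫ ω in B, |(P[fun ω => e0 ω i * e0 ω j | ℱ t]) ω - ∫ z, G xs z i * G xs z j ∂ν| ∂P =
      ∫ ω in B, |(P[f | ℱ t]) ω| ∂P := by
    refine integral_congr_ae (ae_restrict_of_ae ?_)
    filter_upwards [hce, hsub] with ω h1 h2
    rw [h2, Pi.sub_apply, h1]
  have hri : Integrable (fun ω => ‖e0 ω - e ω‖ ^ 2) P := (he0.sub heL).norm.integrable_sq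
  have hei : Integrable (fun ω => ‖e ω‖ ^ 2) P := heL.norm.integrable_sq
  have hrB : ∫ ω in B, ‖e0 ω - e ω‖ ^ 2 ∂P ≤ κ := by
    rw [integral_eq_lintegral_of_nonneg_ae (ae_of_all _ fun ω => sq_nonneg _)
      hri.aestronglyMeasurable.restrict]
    refine ENNReal.toReal_le_of_le_ofReal hκ ?_
    simpa [he] using hle
  have heB : ∫ ω in B, ‖e ω‖ ^ 2 ∂P ≤ ∫ z, ‖G xs z‖ ^ 2 ∂ν := by
    refine (setIntegral_le_integral hei (ae_of_all _ fun ω => sq_nonneg _)).trans (le_of_eq ?_)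
    simp only [he, norm_neg]
    exact hξ.integral_comp t ((measurable_section hG xs).norm.pow_const 2)
  rw [e1]
  calc ∫ ω in B, |(P[f | ℱ t]) ω| ∂P ≤ ∫ ω in B, |f ω| ∂P := setIntegral_abs_condExp_le hBm f
    _ ≤ ∫ ω in B, ((1 + 1 / τ) * ‖e0 ω - e ω‖ ^ 2 + τ * ‖e ω‖ ^ 2) ∂P := by
        refine integral_mono hfi.abs.integrableOn
          ((hri.const_mul _).add (hei.const_mul _)).integrableOn fun ω => ?_
        exact abs_mul_apply_sub_le (e0 ω) (e ω) i j hτ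
    _ = (1 + 1 / τ) * ∫ ω in B, ‖e0 ω - e ω‖ ^ 2 ∂P + τ * ∫ ω in B, ‖e ω‖ ^ 2 ∂P := by
        rw [integral_add (hri.const_mul _).integrableOn (hei.const_mul _).integrableOn,
          integral_const_mul, integral_const_mul]
    _ ≤ _ := by gcongr

/-- The limiting covariance of the noise is the covariance of `G(x*, ξ)`. -/
theorem NoiseCondition.covariance_eq {S : Mat d} {p : ℝ}
    (h : NoiseCondition P ℱ ν G xs x (noise G ν ξ x) S p) (hξ : IsDataStream P ℱ ν ξ)
    (hx : ∀ t, Measurable[ℱ t] (x t)) (hG : Measurable fun q : Vec d × Ξ => G q.1 q.2)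
    (hLip : LipschitzL2 G ν) (hxs : MemLp (G xs) 2 ν) (hroot : meanField G ν xs = 0)
    (hlim : ∀ᵐ ω ∂P, Tendsto (fun t => x t ω) atTop (𝓝 xs)) (i j : Fin d) :
    S i j = ∫ z, G xs z i * G xs z j ∂ν := by
  obtain ⟨L, hL0, hL⟩ := hLip
  obtain ⟨e0, ζ, he0, hζ, hdec, -, hS, -, δ, hδ, hζle⟩ := h.decomposition
  set T := ∫ z, G xs z i * G xs z j ∂ν with hT
  set M := ∫ z, ‖G xs z‖ ^ 2 ∂ν with hM
  have hM0 : 0 ≤ M := integral_nonneg fun z => sq_nonneg _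
  set Q : ℕ → Ω → ℝ := fun t => P[fun ω => e0 t ω i * e0 t ω j | ℱ t] with hQ
  by_contra hne
  set γ := |S i j - T| with hγ
  have hγ0 : 0 < γ := abs_pos.2 (sub_ne_zero.2 hne)
  set τ := γ / (16 * (M + 1)) with hτ
  have hτ0 : 0 < τ := by positivity
  have hτM : τ * M ≤ γ / 16 := by
    rw [hτ, div_mul_eq_mul_div, div_le_div_iff₀ (by positivity) (by norm_num)]
    nlinarith
  set κ := γ / 16 / (1 + 1 / τ) with hκ
  have hκ0 : 0 < κ := by positivity
  have hκe : (1 + 1 / τ) * κ = γ / 16 := by rw [hκ]; field_simp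
  obtain ⟨ρ₁, hρ₁, hδρ⟩ := Metric.eventually_nhds_iff_ball.1
    (hδ.eventually (ge_mem_nhds (show (0 : ℝ) < κ / 6 by positivity)))
  set ρ := min (ρ₁ / 2) (min 1 (κ / (12 * L ^ 2))) with hρ
  have hρ0 : 0 < ρ := by positivity
  have hρsq : 6 * L ^ 2 * ρ ^ 2 ≤ κ / 2 := by
    have h1 : ρ ≤ 1 := (min_le_right _ _).trans (min_le_left _ _)
    have h2 : ρ ≤ κ / (12 * L ^ 2) := (min_le_right _ _).trans (min_le_right _ _)
    rw [le_div_iff₀ (by positivity)] at h2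
    have h3 : ρ ^ 2 ≤ ρ := by nlinarith
    nlinarith [mul_le_mul_of_nonneg_left h3 (sq_nonneg L)]
  set B : ℕ → Set Ω := fun t => {ω | ‖x t ω - xs‖ ≤ ρ} with hB
  have hxm : ∀ t, Measurable (x t) := fun t => (hx t).mono (ℱ.le t) le_rfl
  have hBm : ∀ t, MeasurableSet (B t) := fun t => measurableSet_norm_sub_le (hxm t) xs ρ
  have hint : ∀ᶠ t in atTop, ∫ ω in B t, |Q t ω - T| ∂P ≤ γ / 8 := by
    filter_upwards [hζle] with t ht
    have h1 := setLIntegral_noise_add_sq_le (ρ := ρ) hξ hx hG hL0.le hL hxs hroot (hζ t) (hdec t)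
      (show 0 ≤ κ / 6 by positivity) (by
        filter_upwards [ht] with ω h1 h2
        refine h1.trans (hδρ _ ?_)
        rw [mem_ball_zero_iff]
        exact (h2.trans (min_le_left _ _)).trans_lt (by linarith))
    have h2 := h1.trans (ENNReal.ofReal_le_ofReal (show _ ≤ κ by linarith))
    have h3 := setIntegral_abs_condExp_sub_le hξ hx hG hxs (he0 t) hκ0.le hτ0 h2 i j
    refine h3.trans ?_
    rw [hκe]
    linarith
  have hev1 : ∀ᶠ t in atTop, P.real {ω | ρ ≤ dist (x t ω) xs} ≤ 1 / 4 := by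
    have h1 : TendstoInMeasure P x atTop fun _ => xs :=
      tendstoInMeasure_of_tendsto_ae (fun t => (hxm t).aestronglyMeasurable) hlim
    exact (tendstoInMeasure_iff_measureReal_dist.1 h1 ρ hρ0).eventually
      (ge_mem_nhds (by norm_num))
  have hev2 : ∀ᶠ t in atTop, P.real {ω | γ / 2 ≤ dist (Q t ω) (S i j)} ≤ 1 / 4 :=
    (tendstoInMeasure_iff_measureReal_dist.1 (hS i j) (γ / 2) (by positivity)).eventually
      (ge_mem_nhds (by norm_num))
  obtain ⟨t, ht, ht1, ht2⟩ := (hint.and (hev1.and hev2)).exists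
  have ht3 : P.real ({ω | γ / 2 ≤ |Q t ω - T|} ∩ B t) ≤ 1 / 4 := by
    have hQi : Integrable (fun ω => |Q t ω - T|) (P.restrict (B t)) :=
      (integrable_condExp.sub (integrable_const T)).abs.integrableOn
    have h1 := mul_meas_ge_le_integral_of_nonneg (ae_of_all _ fun ω => abs_nonneg _) hQi (γ / 2)
    rw [measureReal_restrict_apply' (hBm t)] at h1
    nlinarith
  have hcover : (Set.univ : Set Ω) ⊆ {ω | ρ ≤ dist (x t ω) xs} ∪
      ({ω | γ / 2 ≤ dist (Q t ω) (S i j)} ∪ ({ω | γ / 2 ≤ |Q t ω - T|} ∩ B t)) := by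
    intro ω _
    by_cases h1 : ρ ≤ dist (x t ω) xs
    · exact Or.inl h1
    by_cases h2 : γ / 2 ≤ dist (Q t ω) (S i j)
    · exact Or.inr (Or.inl h2)
    refine Or.inr (Or.inr ⟨?_, ?_⟩)
    · have h3 : γ ≤ |Q t ω - T| + dist (Q t ω) (S i j) := by
        rw [Real.dist_eq, abs_sub_comm (Q t ω) (S i j), add_comm]
        exact abs_sub_le _ _ _
      simp only [Set.mem_ofPred_eq]
      linarith
    · have h3 := (not_le.1 h1).le
      rwa [dist_eq_norm] at h3
  have h1 := measureReal_mono (μ := P) hcover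
  rw [probReal_univ] at h1
  have h2 := h1.trans ((measureReal_union_le _ _).trans
    (add_le_add_right (measureReal_union_le _ _) _))
  linarith

end Covariance

/-! ### Entries of matrices -/

theorem abs_apply_le_norm {d : ℕ} (A : Mat d) (i j : Fin d) : |A i j| ≤ ‖A‖ := by
  have h1 := Matrix.l2_opNorm_mulVec A (EuclideanSpace.single j (1 : ℝ))
  have h2 := PiLp.norm_apply_le
    ((EuclideanSpace.equiv (Fin d) ℝ).symm (A *ᵥ (EuclideanSpace.single j (1 : ℝ)).ofLp)) i
  simp only [PiLp.norm_single, norm_one, mul_one] at h1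
  refine le_trans (le_of_eq ?_) (h2.trans h1)
  simp

theorem isLittleO_of_apply {d : ℕ} {α : Type*} {l : Filter α} {X : α → Mat d} {r : α → ℝ}
    (h : ∀ i j, (fun t => X t i j) =o[l] r) : X =o[l] r := by
  have e : X = fun t => ∑ i, ∑ j, X t i j • Matrix.single i j (1 : ℝ) := by
    ext1 t
    conv_lhs => rw [Matrix.matrix_eq_sum_single (X t)]
    simp [Matrix.smul_single]
  have key : ∀ i j, (fun t => X t i j • (Matrix.single i j (1 : ℝ) : Mat d)) =o[l] r := by
    intro i j
    refine IsBigO.trans_isLittleO ?_ (h i j)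
    refine IsBigO.of_bound ‖(Matrix.single i j (1 : ℝ) : Mat d)‖ (Eventually.of_forall fun t => ?_)
    rw [norm_smul, mul_comm]
  rw [e]
  exact IsLittleO.fun_sum fun i _ => IsLittleO.fun_sum fun j _ => key i j

theorem isTildeLittleOAS_of_apply {d : ℕ} {Ω : Type*} {mΩ : MeasurableSpace Ω} {P : Measure Ω}
    {X : ℕ → Ω → Mat d} {r : ℕ → ℝ} (k : ℕ)
    (h : ∀ i j, ∀ᵐ ω ∂P, (fun t => X t ω i j) =o[atTop] fun t : ℕ => r t * Real.log t ^ k) :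
    IsTildeLittleOAS P X r := by
  refine ⟨k, ?_⟩
  filter_upwards [ae_all_iff.2 fun i => ae_all_iff.2 (h i)] with ω hω
  exact isLittleO_of_apply hω

theorem memLp_of_lintegral_rpow_lt_top {Ξ E : Type*} [MeasurableSpace Ξ] [NormedAddCommGroup E]
    {ν : Measure Ξ} {f : Ξ → E} {q : ℝ} (hq : 0 < q) (hf : AEStronglyMeasurable f ν)
    (h : ∫⁻ z, ‖f z‖ₑ ^ q ∂ν < ∞) : MemLp f (ENNReal.ofReal q) ν := by
  refine ⟨hf, ?_⟩
  rw [eLpNorm_lt_top_iff_lintegral_rpow_enorm_lt_top (by simpa using hq) ENNReal.ofReal_ne_top,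
    ENNReal.toReal_ofReal hq.le]
  exact h

theorem RateCondition.two_lt {lam p a LH : ℝ} (h : RateCondition lam p a LH) (ha : 1 / 2 < a)
    (hp : 1 < p) : 2 < p := by
  have h1 : a < (p - 1) / p := by
    rcases h with ⟨-, -, h⟩ | ⟨-, -, h⟩ <;> exact h
  rw [lt_div_iff₀ (by linarith)] at h1
  nlinarith

section Products

variable {d : ℕ} {Ξ : Type*} [MeasurableSpace Ξ] {ν : Measure Ξ}
  {G : Vec d → Ξ → Vec d} {xs : Vec d} {L : ℝ}

theorem measurable_apply_mul_apply (hG : Measurable fun q : Vec d × Ξ => G q.1 q.2)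
    (i j : Fin d) : Measurable fun q : Vec d × Ξ => G q.1 q.2 i * G q.1 q.2 j := by
  have h1 : ∀ k, Measurable fun q : Vec d × Ξ => G q.1 q.2 k := fun k =>
    (EuclideanSpace.proj k : Vec d →L[ℝ] ℝ).continuous.measurable.comp hG
  exact (h1 i).mul (h1 j)

theorem lintegral_abs_apply_mul_apply_sub_le (hL0 : 0 ≤ L)
    (hG : Measurable fun q : Vec d × Ξ => G q.1 q.2)
    (hL : ∀ x y, eLpNorm (fun z => G x z - G y z) 2 ν ≤ ENNReal.ofReal (L * ‖x - y‖))
    (hxs : MemLp (G xs) 2 ν) (i j : Fin d) {y : Vec d} (hy : ‖y - xs‖ ≤ 1) :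
    ∫⁻ z, ENNReal.ofReal |G y z i * G y z j - G xs z i * G xs z j| ∂ν ≤
      ENNReal.ofReal ((2 * L ^ 2 + ∫ z, ‖G xs z‖ ^ 2 ∂ν) * ‖y - xs‖) := by
  rcases eq_or_ne y xs with rfl | hne
  · simp
  set r := ‖y - xs‖ with hr
  have hr0 : 0 < r := norm_pos_iff.2 (sub_ne_zero.2 hne)
  have hi1 : Integrable (fun z => ‖G y z - G xs z‖ ^ 2) ν :=
    ((memLp_two_of_lipschitz hG hL hxs y).sub hxs).norm.integrable_sq
  have hi2 : Integrable (fun z => ‖G xs z‖ ^ 2) ν := hxs.norm.integrable_sq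
  have hi : Integrable (fun z => (1 + 1 / r) * ‖G y z - G xs z‖ ^ 2 + r * ‖G xs z‖ ^ 2) ν :=
    (hi1.const_mul _).add (hi2.const_mul _)
  refine (lintegral_mono fun z => ENNReal.ofReal_le_ofReal
    (abs_mul_apply_sub_le (G y z) (G xs z) i j hr0)).trans ?_
  rw [← ofReal_integral_eq_lintegral_ofReal hi (ae_of_all _ fun z => by positivity),
    integral_add (hi1.const_mul _) (hi2.const_mul _), integral_const_mul, integral_const_mul]
  refine ENNReal.ofReal_le_ofReal ?_
  have h1 := integral_norm_sub_sq_le hL0 hG hL y xs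
  have h2 : (1 + 1 / r) * ∫ z, ‖G y z - G xs z‖ ^ 2 ∂ν ≤ (1 + 1 / r) * (L ^ 2 * r ^ 2) := by
    gcongr
  have h3 : (1 + 1 / r) * (L ^ 2 * r ^ 2) = L ^ 2 * (r ^ 2 + r) := by field_simp
  have h4 : L ^ 2 * (r ^ 2 + r) ≤ L ^ 2 * (2 * r) := by
    gcongr
    nlinarith
  nlinarith

theorem memLp_two_apply_mul_apply (hxs : MemLp (G xs) 4 ν) (i j : Fin d) :
    MemLp (fun z => G xs z i * G xs z j) 2 ν := by
  have hc : ∀ k, AEStronglyMeasurable (fun z => G xs z k) ν := fun k =>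
    (EuclideanSpace.proj k : Vec d →L[ℝ] ℝ).continuous.comp_aestronglyMeasurable
      hxs.aestronglyMeasurable
  have hm : AEStronglyMeasurable (fun z => G xs z i * G xs z j) ν := (hc i).mul (hc j)
  rw [memLp_two_iff_integrable_sq hm]
  have h4 : Integrable (fun z => ‖G xs z‖ ^ 4) ν :=
    MemLp.integrable_norm_pow (p := 4) (by exact_mod_cast hxs) (by norm_num)
  refine h4.mono' (hm.pow 2) (ae_of_all _ fun z => ?_)
  have hk : ∀ k, |G xs z k| ≤ ‖G xs z‖ := fun k => by simpa using PiLp.norm_apply_le (G xs z) k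
  rw [norm_pow, norm_mul, Real.norm_eq_abs, Real.norm_eq_abs]
  calc (|G xs z i| * |G xs z j|) ^ 2 ≤ (‖G xs z‖ * ‖G xs z‖) ^ 2 := by
        gcongr <;> exact hk _
    _ = ‖G xs z‖ ^ 4 := by ring

end Products

end StochApprox

end

theorem mainTheorem6 {d : ℕ} {Ω Ξ : Type*} [mΩ : MeasurableSpace Ω] [MeasurableSpace Ξ]
    (P : Measure Ω) [IsProbabilityMeasure P] (ℱ : Filtration ℕ mΩ)
    (ν : Measure Ξ) (ξ : ℕ → Ω → Ξ) (hξ : StochApprox.IsDataStream P ℱ ν ξ)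
    (G : StochApprox.Vec d → Ξ → StochApprox.Vec d)
    (hG : Measurable (fun q : StochApprox.Vec d × Ξ => G q.1 q.2))
    (x₀ : Ω → StochApprox.Vec d) (hx₀ : Measurable[ℱ 0] x₀)
    (xs : StochApprox.Vec d) (hroot : StochApprox.meanField G ν xs = 0)
    (η₀ a : ℝ) (hη₀ : 0 < η₀) (ha : 1 / 2 < a) (ha' : a < 1)
    (x : ℕ → Ω → StochApprox.Vec d)
    (hx : x = StochApprox.iterate G (StochApprox.stepSize η₀ a) ξ x₀)
    (H S : StochApprox.Mat d) (LH lam p pbar : ℝ)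
    (hLyap : StochApprox.LyapunovCondition (StochApprox.meanField G ν) xs)
    (hLin : StochApprox.LocalLinearity (StochApprox.meanField G ν) xs H LH lam)
    (hLip : StochApprox.LipschitzL2 G ν)
    (hNoise : StochApprox.NoiseCondition P ℱ ν G xs x (StochApprox.noise G ν ξ x) S p)
    (hRate : StochApprox.RateCondition lam p a LH)
    (Hbar : StochApprox.Vec d → Ξ → StochApprox.Mat d)
    (hHbar : ∀ i j, Measurable (fun q : StochApprox.Vec d × Ξ => Hbar q.1 q.2 i j))
    (hUnb : StochApprox.UnbiasedEstimate Hbar ν xs H pbar)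
    (hLipH : StochApprox.LipschitzL2 Hbar ν) :
    StochApprox.IsTildeLittleOAS P
        (fun t ω => StochApprox.Hhat Hbar ξ x t ω - H)
        (fun t => (t : ℝ) ^ (-min (1 - 1 / pbar) (a / 2))) ∧
      StochApprox.IsTildeLittleOAS P
        (fun t ω => StochApprox.Shat G ξ x t ω - S)
        (fun t => (t : ℝ) ^ (-(a / 2))) := by
  have hν := hξ.isProbabilityMeasure
  have hp2 : 2 < p := hRate.two_lt ha hNoise.one_lt
  have hGxs : MemLp (G xs) (ENNReal.ofReal (2 * p)) ν := by
    obtain ⟨Cε, -, hC⟩ := hNoise.moment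
    exact StochApprox.memLp_of_lintegral_rpow_lt_top (by linarith)
      (StochApprox.measurable_section hG xs).aestronglyMeasurable
      (hC.trans_lt ENNReal.ofReal_lt_top)
  have hxs4 : MemLp (G xs) 4 ν := hGxs.mono_exponent (by
    rw [show (4 : ℝ≥0∞) = ENNReal.ofReal 4 by norm_num]
    exact ENNReal.ofReal_le_ofReal (by linarith))
  have hxs2 : MemLp (G xs) 2 ν := hxs4.mono_exponent (by norm_num)
  have hxm : ∀ t, Measurable[ℱ t] (x t) := by
    rw [hx]; exact StochApprox.measurable_iterate hξ hG hx₀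
  obtain ⟨v, D, μ, C, hdrift, δ, lamV, hδ, hlam, hloc⟩ :=
    hLyap.exists_isDrift hG hroot hLip hxs2
  have hlim : ∀ᵐ ω ∂P, Tendsto (fun t => x t ω) atTop (𝓝 xs) := by
    rw [hx]
    exact hdrift.ae_tendsto_iterate hξ hG hx₀ (StochApprox.stepSize_nonneg hη₀)
      (StochApprox.summable_stepSize_sq ha) (StochApprox.not_summable_stepSize hη₀ ha')
  have hδ' : 0 < min δ 1 := lt_min hδ one_pos
  have hrate : ∀ N, ∃ K : ℝ, ∀ᶠ j : ℕ in atTop,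
      ∫⁻ ω in StochApprox.stayEvent x xs (min δ 1) N j, ENNReal.ofReal ‖x j ω - xs‖ ∂P ≤
        ENNReal.ofReal (K * (j : ℝ) ^ (-(a / 2))) := by
    rw [hx]
    exact hdrift.setLIntegral_norm_stayEvent_le hξ hG hx₀ hη₀ (by linarith) ha' hlam
      fun y hy => hloc y (hy.trans (min_le_left _ _))
  constructor
  · obtain ⟨hpbar, hHeq, hHmom⟩ := hUnb
    obtain ⟨L, hL0, hL⟩ := hLipH
    refine StochApprox.isTildeLittleOAS_of_apply 3 fun i j => ?_
    have hent : ∀ y, Measurable fun z => Hbar y z i j := fun y =>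
      (hHbar i j).comp measurable_prodMk_left
    have hLp : MemLp (fun z => Hbar xs z i j) (ENNReal.ofReal pbar) ν := by
      refine StochApprox.memLp_of_lintegral_rpow_lt_top (by linarith)
        (hent xs).aestronglyMeasurable (lt_of_le_of_lt (lintegral_mono fun z => ?_) hHmom)
      refine ENNReal.rpow_le_rpow ?_ (by linarith)
      rw [enorm_le_iff_norm_le]
      exact StochApprox.abs_apply_le_norm _ i j
    have hloc1 : ∀ y, ‖y - xs‖ ≤ min δ 1 →
        ∫⁻ z, ENNReal.ofReal |Hbar y z i j - Hbar xs z i j| ∂ν ≤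
          ENNReal.ofReal (L * ‖y - xs‖) := by
      intro y _
      have h1 : eLpNorm (fun z => Hbar y z i j - Hbar xs z i j) 2 ν ≤
          ENNReal.ofReal (L * ‖y - xs‖) :=
        (eLpNorm_mono fun z => StochApprox.abs_apply_le_norm (Hbar y z - Hbar xs z) i j).trans
          (hL y xs)
      have h2 := StochApprox.lintegral_enorm_le_of_eLpNorm_two_le
        ((hent y).sub (hent xs)).aestronglyMeasurable h1
      simpa only [Pi.sub_apply, ← ofReal_norm, Real.norm_eq_abs] using h2
    have hq1 : 1 ≤ min pbar 2 := le_min hpbar.le (by norm_num)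
    have hrq : min (1 - 1 / pbar) (a / 2) ≤ 1 - 1 / min pbar 2 := by
      rcases le_total pbar 2 with h | h
      · rw [min_eq_left h]; exact min_le_left _ _
      · rw [min_eq_right h]; exact (min_le_right _ _).trans (by linarith)
    filter_upwards [StochApprox.ae_isLittleO_average_sub (F := fun y z => Hbar y z i j) hξ hxm hlim
      (hHbar i j) hδ' (by linarith) (by linarith) hL0.le hloc1 hrate hq1 (min_le_right _ _)
      (hLp.mono_exponent (ENNReal.ofReal_le_ofReal (min_le_left _ _))) hrq (min_le_right _ _)]
      with ω hω
    refine hω.congr_left fun t => ?_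
    simp [StochApprox.Hhat, hHeq i j, Matrix.sum_apply]
  · obtain ⟨L, hL0, hL⟩ := id hLip
    refine StochApprox.isTildeLittleOAS_of_apply 3 fun i j => ?_
    have hS := hNoise.covariance_eq hξ hxm hG hLip hxs2 hroot hlim i j
    have hM0 : 0 ≤ ∫ z, ‖G xs z‖ ^ 2 ∂ν := integral_nonneg fun z => sq_nonneg _
    filter_upwards [StochApprox.ae_isLittleO_average_sub (F := fun y z => G y z i * G y z j)
      (q := 2) (r := a / 2) hξ hxm hlim
      (StochApprox.measurable_apply_mul_apply hG i j) hδ' (by linarith) (by linarith)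
      (by positivity) (fun y hy => StochApprox.lintegral_abs_apply_mul_apply_sub_le hL0.le hG hL
        hxs2 i j (hy.trans (min_le_right _ _))) hrate (by norm_num) le_rfl
      (by simpa using StochApprox.memLp_two_apply_mul_apply hxs4 i j) (by linarith) le_rfl]
      with ω hω
    refine hω.congr_left fun t => ?_
    simp [StochApprox.Shat, StochApprox.outer, hS, Matrix.sum_apply, Matrix.vecMulVec_apply]
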